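/- **Conventions.** A vocabulary is a finite set of relation names with arities in $\{0,1,2,\dots\}$. A structure has a finite, possibly empty, universe. A class of structures is a class, closed under isomorphism, of structures over one vocabulary. Functions between classes are considered up to isomorphism of their outputs. *Pairs.* For classes $\Gamma,\Sigma$, the class $\Gamma\times\Sigma$ consists of the disjoint unions of a structure $B\in\Gamma$ and a structure $A\in\Sigma$, over the disjoint union of the two vocabularies, with an additional unary relation selecting the elements of $B$. *Lists.* The class $\Sigma^*$ consists of the disjoint unions of finite (possibly empty) lists $[A_1,\dots,A_n]$ of structures from $\Sigma$ with nonempty universes, over the vocabulary of $\Sigma$ in which every nullary name $R()$ is replaced by a unary name $R(x)$, true for $x\in A_i$ iff $R()$ holds in $A_i$, and with an additional binary relation that holds for $x\in A_i$, $y\in A_j$ iff $i\le j$. *Co-pairs.* The class $\Gamma+\Sigma$ consists of the structures of $\Gamma$ and of $\Sigma$, over the disjoint union of the vocabularies (the names of the other class being interpreted as empty), with an additional nullary relation that tells which of the two classes the structure comes from. The class $1$ has, up to isomorphism, a single structure, with a one-element universe and no relations. *Interpretations.* An MSO interpretation $f:\Sigma\to\Gamma$ is given by a polynomial functor $F(A)=A^{k_1}+\dots+A^{k_c}$,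 by MSO formulas that select a subset of $F(A)$ as the universe of $f(A)$ (one formula with $k_i$ free variables for each component), and, for every relation name $R$ of $\Gamma$, of arity $m$, by MSO formulas (one for each component of $F^m$) that define $R$ in $f(A)$. It is *linear* if all $k_i\le 1$. It is *quantifier-free* if $F(A)=A$ and all formulas are quantifier-free. **Theorem.** (1) Let $\Sigma$ and $\Gamma$ be arbitrary classes of structures, let $B_0\in\Gamma$, and let $\delta:\Gamma\times\Sigma\to\Gamma$ be a quantifier-free interpretation. Then folding is well defined on structures, that is, there is a function $\Sigma^*\to\Gamma$, unique up to isomorphism of outputs, that maps $[A_1,\dots,A_n]$ to the last state $B_n$ of the run $B_i=\delta(B_{i-1},A_i)$, and this function is a linear MSO interpretation. (2) In particular, simple streaming string transducers compute linear MSO interpretations. Let $\Sigma$ and $\Gamma$ be finite nonempty alphabets, each viewed as a class $1+\dots+1$ with one summand for each letter, let $\Delta=(\Gamma^*)^{k_1}+\dots+(\Gamma^*)^{k_m}$ with $m\ge 1$ and $k_i\ge 0$ (where $(\Gamma^*)^0=1$), and let $1\to\Delta$, $\Delta\times\Sigma\to\Delta$ and $\Delta\to\Gamma^*$ be quantifier-free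 interpretations. Then the function $\Sigma^*\to\Gamma^*$ obtained by folding the first two and post-composing with the third is well defined and is a linear MSO interpretation. -/

import Mathlib

universe u

namespace FoldMSO

/-! ### Vocabularies, finite structures, classes of structures -/

/-- A vocabulary: finitely many relation names (arity `0` is allowed), no function symbols. -/
structure Vocabulary where
  lang : FirstOrder.Language.{0, 0}
  relational : lang.IsRelational
  finite : Finite (Σ n, lang.Relations n)

/-- The relation names of arity `n`. -/
abbrev Vocabulary.Rel (V : Vocabulary) (n : ℕ) : Type := V.lang.Relations n

/-- The vocabulary with the given relation names. -/
def Vocabulary.ofRel (R : ℕ → Type) (h : Finite (Σ n, R n)) : Vocabulary where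
  lang := ⟨fun _ => Empty, R⟩
  relational := fun _ => inferInstanceAs (IsEmpty Empty)
  finite := h

/-- An interpretation of the relation names makes a type a structure. -/
@[reducible]
def Vocabulary.mkStr (V : Vocabulary) (A : Type u)
    (r : ∀ {n : ℕ}, V.Rel n → (Fin n → A) → Prop) : V.lang.Structure A where
  funMap := fun {n} f _ => ((V.relational n).false f).elim
  RelMap := r

/-- A structure: a finite, possibly empty, universe with an interpretation of the vocabulary. -/
structure FinStr (V : Vocabulary) where
  carrier : Type u
  [str : V.lang.Structure carrier]
  [fin : Finite carrier]

attribute [instance] FinStr.str FinStr.fin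

/-- The tuple `xs` satisfies the relation `R` in the structure `A`. -/
abbrev FinStr.Holds {V : Vocabulary} (A : FinStr.{u} V) {n : ℕ} (R : V.Rel n)
    (xs : Fin n → A.carrier) : Prop :=
  FirstOrder.Language.Structure.RelMap R xs

/-- Isomorphism of structures. -/
def FinStr.Iso {V : Vocabulary} (A B : FinStr.{u} V) : Prop :=
  Nonempty (FirstOrder.Language.Equiv V.lang A.carrier B.carrier)

theorem FinStr.Iso.trans {V : Vocabulary} {A B C : FinStr.{u} V} (h : A.Iso B) (k : B.Iso C) :
    A.Iso C :=
  h.elim fun e => k.elim fun g => ⟨g.comp e⟩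

theorem FinStr.Iso.symm {V : Vocabulary} {A B : FinStr.{u} V} (h : A.Iso B) : B.Iso A :=
  h.elim fun e => ⟨e.symm⟩

theorem FinStr.Iso.refl {V : Vocabulary} (A : FinStr.{u} V) : A.Iso A :=
  ⟨FirstOrder.Language.Equiv.refl _ _⟩

/-- A class of structures over a common vocabulary, closed under isomorphism. -/
structure StrClass (V : Vocabulary) where
  Mem : FinStr.{u} V → Prop
  closed : ∀ {A B : FinStr.{u} V}, A.Iso B → Mem A → Mem B

/-- The structures of a class. -/
abbrev StrClass.Obj {V : Vocabulary} (C : StrClass.{u} V) : Type (u + 1) :=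
  {A : FinStr.{u} V // C.Mem A}

/-- The nonempty structures of a class; these are the possible items of a list. -/
abbrev StrClass.Item {V : Vocabulary} (C : StrClass.{u} V) : Type (u + 1) :=
  {A : C.Obj // Nonempty A.1.carrier}

/-! ### Pairs -/

/-- Relation names for pairs: those of the two coordinates, and a new unary relation. -/
inductive ProdRel (R S : ℕ → Type) : ℕ → Type
  | left {n : ℕ} (r : R n) : ProdRel R S n
  | right {n : ℕ} (s : S n) : ProdRel R S n
  | isFst : ProdRel R S 1

/-- The vocabulary of pairs. -/
def Vocabulary.prod (V W : Vocabulary) : Vocabulary :=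
  Vocabulary.ofRel (ProdRel V.Rel W.Rel) (by
    have := V.finite
    have := W.finite
    refine Finite.of_surjective
      (fun x : ((Σ n, V.Rel n) ⊕ (Σ n, W.Rel n)) ⊕ Unit => (match x with
        | .inl (.inl r) => ⟨r.1, .left r.2⟩
        | .inl (.inr r) => ⟨r.1, .right r.2⟩
        | .inr _ => ⟨1, .isFst⟩ : Σ n, ProdRel V.Rel W.Rel n)) ?_
    rintro ⟨n, r | r | _⟩
    · exact ⟨.inl (.inl ⟨_, r⟩), rfl⟩
    · exact ⟨.inl (.inr ⟨_, r⟩), rfl⟩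
    · exact ⟨.inr (), rfl⟩)

/-- The interpretation of the relation names in the disjoint union of two structures. -/
def prodHolds {V W : Vocabulary} (A : FinStr.{u} V) (B : FinStr.{u} W) :
    ∀ {n : ℕ}, ProdRel V.Rel W.Rel n → (Fin n → A.carrier ⊕ B.carrier) → Prop
  | _, .left R, xs => ∃ ys : Fin _ → A.carrier, xs = (fun i => Sum.inl (ys i)) ∧ A.Holds R ys
  | _, .right R, xs => ∃ ys : Fin _ → B.carrier, xs = (fun i => Sum.inr (ys i)) ∧ B.Holds R ys
  | _, .isFst, xs => (xs 0).isLeft = true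

/-- The pair `(A, B)`, as a structure. -/
def FinStr.prod {V W : Vocabulary} (A : FinStr.{u} V) (B : FinStr.{u} W) :
    FinStr.{u} (V.prod W) where
  carrier := A.carrier ⊕ B.carrier
  str := (V.prod W).mkStr _ (prodHolds A B)

/-- The class `C × D`. -/
def StrClass.prod {V W : Vocabulary} (C : StrClass.{u} V) (D : StrClass.{u} W) :
    StrClass.{u} (V.prod W) where
  Mem S := ∃ (A : C.Obj) (B : D.Obj), (A.1.prod B.1).Iso S
  closed := fun h ⟨A, B, k⟩ => ⟨A, B, k.trans h⟩

/-- The pair of two members of the classes, as a member of the product class. -/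
def StrClass.pair {V W : Vocabulary} {C : StrClass.{u} V} {D : StrClass.{u} W}
    (A : C.Obj) (B : D.Obj) : (C.prod D).Obj :=
  ⟨A.1.prod B.1, A, B, FinStr.Iso.refl _⟩

/-! ### Lists -/

/-- Relation names for lists: those of positive arity, a unary relation for each nullary one,
and the (pre)order on the elements. -/
inductive ListRel (R : ℕ → Type) : ℕ → Type
  | pos {n : ℕ} (r : R (n + 1)) : ListRel R (n + 1)
  | nullary (r : R 0) : ListRel R 1
  | le : ListRel R 2

/-- The vocabulary of lists. -/
def Vocabulary.list (V : Vocabulary) : Vocabulary :=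
  Vocabulary.ofRel (ListRel V.Rel) (by
    have := V.finite
    refine Finite.of_surjective
      (fun x : (Σ n, V.Rel n) ⊕ Unit => (match x with
        | .inl ⟨0, r⟩ => ⟨1, .nullary r⟩
        | .inl ⟨n + 1, r⟩ => ⟨n + 1, .pos r⟩
        | .inr _ => ⟨2, .le⟩ : Σ n, ListRel V.Rel n)) ?_
    rintro ⟨n, r | r | _⟩
    · exact ⟨.inl ⟨_, r⟩, rfl⟩
    · exact ⟨.inl ⟨0, r⟩, rfl⟩
    · exact ⟨.inr (), rfl⟩)

/-- The interpretation of the relation names in the structure of a list. -/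
def listHolds {V : Vocabulary} {k : ℕ} (A : Fin k → FinStr.{u} V) :
    ∀ {n : ℕ}, ListRel V.Rel n → (Fin n → Σ i, (A i).carrier) → Prop
  | _, .pos R, xs => ∃ (i : Fin k) (ys : Fin _ → (A i).carrier),
      xs = (fun j => ⟨i, ys j⟩) ∧ (A i).Holds R ys
  | _, .nullary R, xs => (A (xs 0).1).Holds R Fin.elim0
  | _, .le, xs => (xs 0).1 ≤ (xs 1).1

/-- The list `[A 0, …, A (k - 1)]`, as a structure. -/
def FinStr.list {V : Vocabulary} {k : ℕ} (A : Fin k → FinStr.{u} V) : FinStr.{u} V.list where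
  carrier := Σ i, (A i).carrier
  str := V.list.mkStr _ (listHolds A)

/-- The class `C*` of lists of nonempty structures from `C`. -/
def StrClass.list {V : Vocabulary} (C : StrClass.{u} V) : StrClass.{u} V.list where
  Mem S := ∃ (k : ℕ) (A : Fin k → C.Item), (FinStr.list fun i => (A i).1.1).Iso S
  closed := fun h ⟨k, A, e⟩ => ⟨k, A, e.trans h⟩

/-! ### Monadic second-order logic -/

/-- Formulas of monadic second-order logic with free element variables in `α`, and with
`m` further element variables and `s` set variables (which may be bound by quantifiers). -/
inductive MSO (V : Vocabulary) (α : Type) : ℕ → ℕ → Type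
  | falsum {m s : ℕ} : MSO V α m s
  | equal {m s : ℕ} (x y : α ⊕ Fin m) : MSO V α m s
  | rel {m s k : ℕ} (R : V.Rel k) (xs : Fin k → α ⊕ Fin m) : MSO V α m s
  | mem {m s : ℕ} (x : α ⊕ Fin m) (X : Fin s) : MSO V α m s
  | imp {m s : ℕ} (φ ψ : MSO V α m s) : MSO V α m s
  | all {m s : ℕ} (φ : MSO V α (m + 1) s) : MSO V α m s
  | allSet {m s : ℕ} (φ : MSO V α m (s + 1)) : MSO V α m s

namespace MSO

variable {V : Vocabulary} {α : Type}

/-- Satisfaction of a formula in a structure, under a valuation of its variables. -/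
def Realize (A : FinStr.{u} V) (v : α → A.carrier) : ∀ {m s : ℕ}, MSO V α m s →
    (Fin m → A.carrier) → (Fin s → Set A.carrier) → Prop
  | _, _, falsum, _, _ => False
  | _, _, equal x y, xs, _ => Sum.elim v xs x = Sum.elim v xs y
  | _, _, rel R ts, xs, _ => A.Holds R fun i => Sum.elim v xs (ts i)
  | _, _, mem x X, xs, Xs => Sum.elim v xs x ∈ Xs X
  | _, _, imp φ ψ, xs, Xs => Realize A v φ xs Xs → Realize A v ψ xs Xs
  | _, _, all φ, xs, Xs => ∀ a : A.carrier, Realize A v φ (Fin.snoc xs a) Xs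
  | _, _, allSet φ, xs, Xs => ∀ X : Set A.carrier, Realize A v φ xs (Fin.snoc Xs X)

/-- The formula has no quantifiers. -/
def IsQF : ∀ {m s : ℕ}, MSO V α m s → Prop
  | _, _, falsum => True
  | _, _, equal _ _ => True
  | _, _, rel _ _ => True
  | _, _, mem _ _ => True
  | _, _, imp φ ψ => IsQF φ ∧ IsQF ψ
  | _, _, all _ => False
  | _, _, allSet _ => False

end MSO

/-- A formula whose free variables are element variables from `α`. -/
abbrev Formula (V : Vocabulary) (α : Type) : Type := MSO V α 0 0

/-- The formula `φ` holds in `A` under the valuation `v`. -/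
def Formula.Sat {V : Vocabulary} {α : Type} (φ : Formula V α) (A : FinStr.{u} V)
    (v : α → A.carrier) : Prop :=
  MSO.Realize A v φ Fin.elim0 Fin.elim0

/-! ### Interpretations -/

/-- The syntax of an interpretation: a polynomial functor `F(A) = A^(dim 0) + A^(dim 1) + ⋯`
with `comps` components, a query of type `F` for the universe, and for every output relation
of arity `m` a query of type `F^m`. A component of `F^m` is given by a choice `c` of `m`
components of `F`, and its dimension is the sum of their dimensions. -/
structure Interpretation (V W : Vocabulary) where
  comps : ℕ
  dim : Fin comps → ℕ
  univ : ∀ c : Fin comps, Formula V (Fin (dim c))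
  rel : ∀ {m : ℕ} (_ : W.Rel m) (c : Fin m → Fin comps), Formula V (Σ i, Fin (dim (c i)))

namespace Interpretation

variable {V W : Vocabulary}

/-- The output candidates `F(A)`. -/
abbrev Candidate (I : Interpretation V W) (A : FinStr.{u} V) : Type u :=
  Σ c : Fin I.comps, (Fin (I.dim c) → A.carrier)

/-- The output structure. -/
def apply (I : Interpretation V W) (A : FinStr.{u} V) : FinStr.{u} W where
  carrier := {x : I.Candidate A // (I.univ x.1).Sat A x.2}
  str := W.mkStr _ fun R xs =>
    (I.rel R fun i => (xs i).1.1).Sat A fun p => (xs p.1).1.2 p.2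

/-- The functor is linear: all components have dimension at most one. -/
def IsLinear (I : Interpretation V W) : Prop := ∀ c, I.dim c ≤ 1

/-- The functor is the identity `F(A) = A` and all formulas are quantifier-free. -/
def IsQF (I : Interpretation V W) : Prop :=
  I.comps = 1 ∧ (∀ c, I.dim c = 1) ∧ (∀ c, (I.univ c).IsQF) ∧
    ∀ {m : ℕ} (R : W.Rel m) (c : Fin m → Fin I.comps), (I.rel R c).IsQF

/-- The interpretation defines the function `f` (structures are identified with their isomorphic
copies). -/
def Defines (I : Interpretation V W) {C : StrClass.{u} V} {D : StrClass.{u} W}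
    (f : C.Obj → D.Obj) : Prop :=
  ∀ A : C.Obj, (I.apply A.1).Iso (f A).1

end Interpretation

/-- The function is a quantifier-free interpretation. -/
def IsQFInterpretation {V W : Vocabulary} {C : StrClass.{u} V} {D : StrClass.{u} W}
    (f : C.Obj → D.Obj) : Prop :=
  ∃ I : Interpretation V W, I.IsQF ∧ I.Defines f

/-- The function is a linear MSO interpretation. -/
def IsLinearMSOInterpretation {V W : Vocabulary} {C : StrClass.{u} V} {D : StrClass.{u} W}
    (f : C.Obj → D.Obj) : Prop :=
  ∃ I : Interpretation V W, I.IsLinear ∧ I.Defines f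

/-! ### Fold -/

/-- The last state of the run of the automaton with transition function `δ` that starts in
state `B` and reads the letters `A 0, …, A (k - 1)`. -/
def lastState {V W : Vocabulary} {S : StrClass.{u} V} {G : StrClass.{u} W}
    (δ : (G.prod S).Obj → G.Obj) (B : G.Obj) {k : ℕ} (A : Fin k → S.Item) : G.Obj :=
  Fin.foldl k (fun B i => δ (StrClass.pair B (A i).1)) B

/-- `f` is the function obtained by folding `δ` from the initial state `B`: it maps (every
structure that represents) a list to the last state of the run, up to isomorphism. -/
def IsFold {V W : Vocabulary} {S : StrClass.{u} V} {G : StrClass.{u} W}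
    (δ : (G.prod S).Obj → G.Obj) (B : G.Obj) (f : S.list.Obj → G.Obj) : Prop :=
  ∀ (k : ℕ) (A : Fin k → S.Item) (w : S.list.Obj),
    (FinStr.list fun i => (A i).1.1).Iso w.1 → (lastState δ B A).1.Iso (f w).1

/-! ### List types -/

/-- Relation names for co-pairs: those of the two summands, and a new nullary relation. -/
inductive SumRel (R S : ℕ → Type) : ℕ → Type
  | left {n : ℕ} (r : R n) : SumRel R S n
  | right {n : ℕ} (s : S n) : SumRel R S n
  | isFst : SumRel R S 0

/-- The vocabulary of co-pairs. -/
def Vocabulary.sum (V W : Vocabulary) : Vocabulary :=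
  Vocabulary.ofRel (SumRel V.Rel W.Rel) (by
    have := V.finite
    have := W.finite
    refine Finite.of_surjective
      (fun x : ((Σ n, V.Rel n) ⊕ (Σ n, W.Rel n)) ⊕ Unit => (match x with
        | .inl (.inl r) => ⟨r.1, .left r.2⟩
        | .inl (.inr r) => ⟨r.1, .right r.2⟩
        | .inr _ => ⟨0, .isFst⟩ : Σ n, SumRel V.Rel W.Rel n)) ?_
    rintro ⟨n, r | r | _⟩
    · exact ⟨.inl (.inl ⟨_, r⟩), rfl⟩
    · exact ⟨.inl (.inr ⟨_, r⟩), rfl⟩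
    · exact ⟨.inr (), rfl⟩)

/-- The relations in a co-pair from the first summand. -/
def inlHolds {V : Vocabulary} (W : Vocabulary) (A : FinStr.{u} V) :
    ∀ {n : ℕ}, SumRel V.Rel W.Rel n → (Fin n → A.carrier) → Prop
  | _, .left R, xs => A.Holds R xs
  | _, .right _, _ => False
  | _, .isFst, _ => True

/-- The relations in a co-pair from the second summand. -/
def inrHolds (V : Vocabulary) {W : Vocabulary} (A : FinStr.{u} W) :
    ∀ {n : ℕ}, SumRel V.Rel W.Rel n → (Fin n → A.carrier) → Prop
  | _, .left _, _ => False
  | _, .right R, xs => A.Holds R xs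
  | _, .isFst, _ => False

/-- A structure of the first summand, as a structure of the co-product. -/
def FinStr.inl {V : Vocabulary} (W : Vocabulary) (A : FinStr.{u} V) : FinStr.{u} (V.sum W) where
  carrier := A.carrier
  str := (V.sum W).mkStr _ (inlHolds W A)

/-- A structure of the second summand, as a structure of the co-product. -/
def FinStr.inr (V : Vocabulary) {W : Vocabulary} (A : FinStr.{u} W) : FinStr.{u} (V.sum W) where
  carrier := A.carrier
  str := (V.sum W).mkStr _ (inrHolds V A)

/-- The class `C + D`. -/
def StrClass.sum {V W : Vocabulary} (C : StrClass.{u} V) (D : StrClass.{u} W) :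
    StrClass.{u} (V.sum W) where
  Mem S := (∃ A : C.Obj, (A.1.inl W).Iso S) ∨ ∃ B : D.Obj, (B.1.inr V).Iso S
  closed := fun h k => k.imp (fun ⟨A, e⟩ => ⟨A, e.trans h⟩) fun ⟨B, e⟩ => ⟨B, e.trans h⟩

/-- The vocabulary with no relation names. -/
def Vocabulary.empty : Vocabulary :=
  Vocabulary.ofRel (fun _ => Empty) (by
    have : IsEmpty (Σ _ : ℕ, Empty) := ⟨fun x => x.2.elim⟩
    infer_instance)

/-- The class `1`: the universe has exactly one element, and there are no relations. -/
def StrClass.one : StrClass.{u} Vocabulary.empty where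
  Mem A := Nonempty (Unique A.carrier)
  closed := fun h k => h.elim fun e => k.elim fun _ => ⟨e.symm.toEquiv.unique⟩

/-- List types. -/
inductive ListType
  | one : ListType
  | prod (s t : ListType) : ListType
  | sum (s t : ListType) : ListType
  | list (t : ListType) : ListType

namespace ListType

/-- The vocabulary of a list type. -/
def voc : ListType → Vocabulary
  | one => Vocabulary.empty
  | prod s t => s.voc.prod t.voc
  | sum s t => s.voc.sum t.voc
  | list t => t.voc.list

/-- The class of structures of a list type. -/
def cls : ∀ t : ListType, StrClass.{u} t.voc
  | one => StrClass.one
  | prod s t => s.cls.prod t.cls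
  | sum s t => s.cls.sum t.cls
  | list t => t.cls.list

/-- The type `1 + ⋯ + 1` with `n + 1` summands: an alphabet with `n + 1` letters. -/
def alphabet : ℕ → ListType
  | 0 => one
  | n + 1 => sum one (alphabet n)

/-- The power `t × ⋯ × t` with `k` factors, which is `1` for `k = 0`. -/
def pow (t : ListType) : ℕ → ListType
  | 0 => one
  | 1 => t
  | k + 2 => prod t (pow t (k + 1))

/-- The polynomial `t ^ k + t ^ k₁ + t ^ k₂ + ⋯`, for `ks = [k₁, k₂, …]`. -/
def poly (t : ListType) (k : ℕ) : List ℕ → ListType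
  | [] => pow t k
  | k' :: ks => sum (pow t k) (poly t k' ks)

end ListType

/-! ### Simple streaming string transducers -/

/-- A simple streaming string transducer. The input alphabet is `1 + ⋯ + 1` with `inp + 1`
summands, the output alphabet is `1 + ⋯ + 1` with `out + 1` summands. The configuration space
is the sum, over the states, of a power of the type of output strings; `regs` and `regss` list
the numbers of registers in the states. -/
structure SimpleSST where
  inp : ℕ
  out : ℕ
  regs : ℕ
  regss : List ℕ
  init : ListType.one.cls.Obj →
    ((ListType.alphabet out).list.poly regs regss).cls.{u}.Obj
  trans : (((ListType.alphabet out).list.poly regs regss).prod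
      (ListType.alphabet inp)).cls.Obj →
    ((ListType.alphabet out).list.poly regs regss).cls.{u}.Obj
  final : ((ListType.alphabet out).list.poly regs regss).cls.Obj →
    (ListType.alphabet out).list.cls.{u}.Obj
  init_qf : IsQFInterpretation init
  trans_qf : IsQFInterpretation trans
  final_qf : IsQFInterpretation final

/-- `f` is the string-to-string function computed by the transducer: fold the initial
configuration and the transition function, then apply the final function. -/
def SimpleSST.Computes (T : SimpleSST.{u})
    (f : (ListType.alphabet T.inp).list.cls.Obj → (ListType.alphabet T.out).list.cls.{u}.Obj) :
    Prop :=
  ∀ e : ListType.one.cls.{u}.Obj,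
    ∃ g : (ListType.alphabet T.inp).list.cls.{u}.Obj →
        ((ListType.alphabet T.out).list.poly T.regs T.regss).cls.{u}.Obj,
      IsFold (S := (ListType.alphabet T.inp).cls) T.trans (T.init e) g ∧
        ∀ w, (T.final (g w)).1.Iso (f w).1

end FoldMSO

namespace FoldMSO

/-! ### Invariance under isomorphism -/

/-! A quantifier-free interpretation creates no elements, so all states of a run live inside one
fixed set, the disjoint union of the initial state and all items. A state is a partial structure on
this set (`PStr`), and the transition function acts on it by `PStr.step`. Whether an atomic fact
about a tuple holds after a step depends only on the atomic facts about the entries of that tuple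
before the step and in the current item.

Hence, once finitely many input elements are named by variables, the restriction of the states to
these elements and to the initial universe evolves on its own (`PStr.step_comap`). It is the run of
a deterministic automaton with finitely many states, described by finitely many bits. MSO expresses
such a run in the classical way: one set variable per bit, containing the elements after whose item
the bit is true (`definable_final`, `isRun_list`, `final_list`). Two variables may name the same
element, so equality is carried along as a relation on names, pulled back from the elements.

Output elements come from the initial state or from the input. A component of dimension 0 for each
element of the initial state and a single component of dimension 1 therefore suffice, and the
interpretation is linear (`exists_linear_iso_runPStr`). It sees only the structure that represents
the list, so lists with isomorphic structures have isomorphic last states, which makes folding well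
defined (`exists_isFold`). For transducers, the final function is absorbed by substituting formulas,
with the functor unchanged (`Interpretation.exists_comp`). -/

theorem FinStr.iso_of_equiv {V : Vocabulary} {A B : FinStr.{u} V} (e : A.carrier ≃ B.carrier)
    (h : ∀ {n : ℕ} (R : V.Rel n) (xs : Fin n → A.carrier),
      B.Holds R (fun i => e (xs i)) ↔ A.Holds R xs) : A.Iso B :=
  ⟨{ toEquiv := e
     map_fun' := fun {n} f _ => ((V.relational n).false f).elim
     map_rel' := fun R xs => h R xs }⟩

theorem FinStr.Iso.exists_equiv {V : Vocabulary} {A B : FinStr.{u} V} (h : A.Iso B) :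
    ∃ e : A.carrier ≃ B.carrier, ∀ {n : ℕ} (R : V.Rel n) (xs : Fin n → A.carrier),
      B.Holds R (fun i => e (xs i)) ↔ A.Holds R xs :=
  h.elim fun e => ⟨e.toEquiv, fun R xs => e.map_rel R xs⟩

theorem sumElim_comp {α : Type*} {β γ δ : Type*} (f : γ → δ) (v : α → γ) (w : β → γ)
    (x : α ⊕ β) :
    Sum.elim (fun a => f (v a)) (fun b => f (w b)) x = f (Sum.elim v w x) := by
  cases x <;> rfl

theorem snoc_map {m : ℕ} {β γ : Type*} (f : β → γ) (xs : Fin m → β) (a : β) :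
    (Fin.snoc (fun i => f (xs i)) (f a) : Fin (m + 1) → γ) =
      fun i => f ((Fin.snoc xs a : Fin (m + 1) → β) i) := by
  funext i
  refine Fin.lastCases ?_ (fun j => ?_) i <;> simp

theorem MSO.realize_iso {V : Vocabulary} {α : Type} {A B : FinStr.{u} V}
    (e : A.carrier ≃ B.carrier)
    (he : ∀ {n : ℕ} (R : V.Rel n) (xs : Fin n → A.carrier),
      B.Holds R (fun i => e (xs i)) ↔ A.Holds R xs) (v : α → A.carrier) {m s : ℕ}
    (φ : MSO V α m s) (xs : Fin m → A.carrier) (Xs : Fin s → Set A.carrier) :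
    φ.Realize B (fun a => e (v a)) (fun i => e (xs i)) (fun i => e '' Xs i) ↔
      φ.Realize A v xs Xs := by
  induction φ with
  | falsum => rfl
  | equal x y => simp only [Realize, sumElim_comp, e.apply_eq_iff_eq]
  | rel R ts => simpa only [Realize, sumElim_comp] using he R _
  | mem x X => simp only [Realize, sumElim_comp, e.injective.mem_set_image]
  | imp φ ψ ih ih' => simp only [Realize, ih, ih']
  | all φ ih =>
    simp only [Realize]
    rw [← e.forall_congr_right]
    simp only [snoc_map, ih]
  | allSet φ ih =>
    simp only [Realize]
    -- Every subset of the target is the image of exactly one subset of the source.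
    rw [← (Equiv.Set.congr e).forall_congr_right]
    refine forall_congr' fun X => ?_
    rw [← ih]
    exact iff_of_eq (congrArg _ (snoc_map (fun Y => e '' Y) Xs X))

theorem Formula.sat_iso {V : Vocabulary} {α : Type} {A B : FinStr.{u} V}
    (e : A.carrier ≃ B.carrier)
    (he : ∀ {n : ℕ} (R : V.Rel n) (xs : Fin n → A.carrier),
      B.Holds R (fun i => e (xs i)) ↔ A.Holds R xs) (φ : Formula V α) (v : α → A.carrier) :
    φ.Sat B (fun a => e (v a)) ↔ φ.Sat A v := by
  unfold Formula.Sat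
  rw [← MSO.realize_iso e he v φ Fin.elim0 Fin.elim0]
  congr! 1

theorem Interpretation.apply_iso {V W : Vocabulary} (I : Interpretation V W) {A B : FinStr.{u} V}
    (h : A.Iso B) : (I.apply A).Iso (I.apply B) := by
  obtain ⟨e, he⟩ := h.exists_equiv
  refine FinStr.iso_of_equiv (Equiv.subtypeEquiv
    (Equiv.sigmaCongrRight fun c => Equiv.arrowCongr (Equiv.refl _) e) ?_) ?_
  · rintro ⟨c, x⟩
    exact (Formula.sat_iso e he (I.univ c) x).symm
  · intro n R xs
    exact Formula.sat_iso e he (I.rel R fun i => (xs i).1.1) _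

theorem FinStr.prod_iso {V W : Vocabulary} {A A' : FinStr.{u} V} {B B' : FinStr.{u} W}
    (h : A.Iso A') (k : B.Iso B') : (A.prod B).Iso (A'.prod B') := by
  obtain ⟨e, he⟩ := h.exists_equiv
  obtain ⟨f, hf⟩ := k.exists_equiv
  refine FinStr.iso_of_equiv (Equiv.sumCongr e f) ?_
  rintro n (R | R | _) xs
  · constructor
    · rintro ⟨ys, h, hR⟩
      refine ⟨fun i => e.symm (ys i), funext fun i => ?_, by rw [← he]; simpa using hR⟩
      exact (Equiv.sumCongr e f).injective ((congrFun h i).trans (by simp; rfl))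
    · rintro ⟨ys, rfl, hR⟩
      exact ⟨fun i => e (ys i), rfl, (he _ _).2 hR⟩
  · constructor
    · rintro ⟨ys, h, hR⟩
      refine ⟨fun i => f.symm (ys i), funext fun i => ?_, by rw [← hf]; simpa using hR⟩
      exact (Equiv.sumCongr e f).injective ((congrFun h i).trans (by simp; rfl))
    · rintro ⟨ys, rfl, hR⟩
      exact ⟨fun i => f (ys i), rfl, (hf _ _).2 hR⟩
  · exact iff_of_eq (congrArg (· = true) (Sum.isLeft_map e f (xs 0)))

/-! ### Quantifier-free formulas -/

/-- Quantifier-free formulas with variables in `α`. -/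
inductive QForm (V : Vocabulary) (α : Type) : Type
  | falsum : QForm V α
  | equal (x y : α) : QForm V α
  | rel {k : ℕ} (R : V.Rel k) (xs : Fin k → α) : QForm V α
  | imp (φ ψ : QForm V α) : QForm V α

namespace QForm

variable {V : Vocabulary} {α : Type}

/-- Truth of a quantifier-free formula, with an arbitrary interpretation of the equality. -/
def Eval {J : Type*} (eq : J → J → Prop) (rel : ∀ {n : ℕ}, V.Rel n → (Fin n → J) → Prop)
    (t : α → J) : QForm V α → Prop
  | .falsum => False
  | .equal x y => eq (t x) (t y)
  | .rel R xs => rel R fun i => t (xs i)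
  | .imp φ ψ => Eval eq rel t φ → Eval eq rel t ψ

/-- Truth of a quantifier-free formula in a structure. -/
abbrev Sat (φ : QForm V α) (A : FinStr.{u} V) (v : α → A.carrier) : Prop :=
  φ.Eval (fun x y => x = y) (fun R xs => A.Holds R xs) v

/-- Without quantifiers the counts of bound variables stay zero throughout the formula, so atoms
mention free variables only and set membership cannot occur. The counts are kept as equations so
that induction on the formula applies. -/
theorem exists_of_isQF_aux {m s : ℕ} (φ : MSO V α m s) (hm : m = 0) (hs : s = 0)
    (h : φ.IsQF) : ∃ ψ : QForm V α, ∀ (A : FinStr.{u} V) (v : α → A.carrier)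
      (xs : Fin m → A.carrier) (Xs : Fin s → Set A.carrier), φ.Realize A v xs Xs ↔ ψ.Sat A v := by
  induction φ with
  | falsum => exact ⟨falsum, fun _ _ _ _ => Iff.rfl⟩
  | equal x y =>
    subst hm
    obtain x | x := x
    · obtain y | y := y
      · exact ⟨equal x y, fun _ _ _ _ => Iff.rfl⟩
      · exact y.elim0
    · exact x.elim0
  | rel R ts =>
    subst hm
    refine ⟨rel R fun i => (ts i).elim id fun j => j.elim0, fun A v xs Xs => ?_⟩
    refine iff_of_eq (congrArg (A.Holds R) (funext fun i => ?_))
    change Sum.elim v xs (ts i) = v (Sum.elim id (fun j => j.elim0) (ts i))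
    obtain x | x := ts i
    · rfl
    · exact x.elim0
  | mem x X => subst hs; exact X.elim0
  | imp φ ψ ih ih' =>
    obtain ⟨a, ha⟩ := ih hm hs h.1
    obtain ⟨b, hb⟩ := ih' hm hs h.2
    exact ⟨imp a b, fun A v xs Xs => imp_congr (ha A v xs Xs) (hb A v xs Xs)⟩
  | all φ ih => exact h.elim
  | allSet φ ih => exact h.elim

theorem exists_of_isQF (φ : Formula V α) (h : φ.IsQF) :
    ∃ ψ : QForm V α, ∀ (A : FinStr.{u} V) (v : α → A.carrier), φ.Sat A v ↔ ψ.Sat A v := by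
  obtain ⟨ψ, hψ⟩ := exists_of_isQF_aux.{u} φ rfl rfl h
  exact ⟨ψ, fun A v => hψ A v _ _⟩

/-- Renaming of variables. -/
def map {β : Type} (f : α → β) : QForm V α → QForm V β
  | falsum => falsum
  | equal x y => equal (f x) (f y)
  | rel R xs => rel R fun i => f (xs i)
  | imp φ ψ => imp (map f φ) (map f ψ)

theorem eval_map {β : Type} (f : α → β) {J : Type*} (eq : J → J → Prop)
    (rel : ∀ {n : ℕ}, V.Rel n → (Fin n → J) → Prop) (t : β → J) (φ : QForm V α) :
    (φ.map f).Eval eq rel t ↔ φ.Eval eq rel (fun a => t (f a)) := by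
  induction φ with
  | falsum => rfl
  | equal x y => rfl
  | rel R xs => rfl
  | imp φ ψ ih ih' => exact imp_congr ih ih'

/-- A quantifier-free formula inspects only the elements named by its variables, so agreement on
those is enough. -/
theorem eval_congr {J : Type*} {eq eq' : J → J → Prop}
    {rel rel' : ∀ {n : ℕ}, V.Rel n → (Fin n → J) → Prop} (t : α → J) (φ : QForm V α)
    (h : ∀ x y, eq (t x) (t y) ↔ eq' (t x) (t y))
    (h' : ∀ {n : ℕ} (R : V.Rel n) (xs : Fin n → α), rel R (fun i => t (xs i)) ↔ rel' R (fun i => t (xs i))) :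
    φ.Eval eq rel t ↔ φ.Eval eq' rel' t := by
  induction φ with
  | falsum => rfl
  | equal x y => exact h x y
  | rel R xs => exact h' R xs
  | imp φ ψ ih ih' => exact imp_congr ih ih'

/-- Pulling back the interpretation of the relations along a map. -/
theorem eval_comp {J E : Type*} (f : J → E) (eq : E → E → Prop)
    (rel : ∀ {n : ℕ}, V.Rel n → (Fin n → E) → Prop) (t : α → J) (φ : QForm V α) :
    φ.Eval (fun x y => eq (f x) (f y)) (fun R xs => rel R fun i => f (xs i)) t ↔
      φ.Eval eq rel fun a => f (t a) := by
  induction φ with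
  | falsum => rfl
  | equal x y => rfl
  | rel R xs => rfl
  | imp φ ψ ih ih' => exact imp_congr ih ih'

theorem sat_iso {A B : FinStr.{u} V} (e : A.carrier ≃ B.carrier)
    (he : ∀ {n : ℕ} (R : V.Rel n) (xs : Fin n → A.carrier),
      B.Holds R (fun i => e (xs i)) ↔ A.Holds R xs) (φ : QForm V α) (v : α → A.carrier) :
    φ.Sat B (fun a => e (v a)) ↔ φ.Sat A v := by
  induction φ with
  | falsum => rfl
  | equal x y => exact e.apply_eq_iff_eq
  | rel R xs => exact he _ _
  | imp φ ψ ih ih' => exact imp_congr ih ih'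

end QForm

/-- The syntax of a quantifier-free interpretation. -/
structure QInterp (V W : Vocabulary) where
  univ : QForm V Unit
  rel : ∀ {m : ℕ}, W.Rel m → QForm V (Fin m)

/-- The output structure of a quantifier-free interpretation. -/
def QInterp.apply {V W : Vocabulary} (I : QInterp V W) (A : FinStr.{u} V) : FinStr.{u} W where
  carrier := {x : A.carrier // I.univ.Sat A fun _ => x}
  str := W.mkStr _ fun R xs => (I.rel R).Sat A fun i => (xs i).1

theorem QInterp.apply_iso {V W : Vocabulary} (I : QInterp V W) {A B : FinStr.{u} V}
    (h : A.Iso B) : (I.apply A).Iso (I.apply B) := by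
  obtain ⟨e, he⟩ := h.exists_equiv
  refine FinStr.iso_of_equiv (e.subtypeEquiv fun x => ?_) ?_
  · exact (QForm.sat_iso e he I.univ fun _ => x).symm
  · intro n R xs
    exact QForm.sat_iso e he (I.rel R) fun i => (xs i).1

theorem Interpretation.IsQF.exists_qInterp {V W : Vocabulary} {I : Interpretation V W}
    (h : I.IsQF) : ∃ Q : QInterp V W, ∀ A : FinStr.{u} V, (I.apply A).Iso (Q.apply A) := by
  obtain ⟨comps, dim, univ, rel⟩ := I
  obtain ⟨h₁, h₂, h₃, h₄⟩ := h
  dsimp only at h₁ h₂ h₃ h₄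
  subst h₁
  obtain rfl : dim = fun _ => 1 := funext h₂
  obtain ⟨φ, hφ⟩ := QForm.exists_of_isQF.{u} (univ 0) (h₃ 0)
  choose r hr using fun (m : ℕ) (R : W.Rel m) =>
    QForm.exists_of_isQF.{u} (rel R fun _ => 0) (h₄ R fun _ => 0)
  refine ⟨⟨φ.map fun _ => (), fun {m} R => (r m R).map fun p => p.1⟩, fun A => ?_⟩
  refine FinStr.iso_of_equiv (Equiv.subtypeEquiv
    ⟨fun x => x.2 0, fun a => ⟨0, fun _ => a⟩, ?_, fun _ => rfl⟩ ?_) ?_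
  · rintro ⟨c, x⟩
    obtain rfl := Subsingleton.elim c 0
    refine congrArg (Sigma.mk _) (funext fun i => ?_)
    exact congrArg x (Subsingleton.elim (0 : Fin 1) i)
  · rintro ⟨c, x⟩
    obtain rfl := Subsingleton.elim c 0
    refine (hφ A x).trans (Iff.trans ?_ (QForm.eval_map _ _ _ _ _).symm)
    refine iff_of_eq (congrArg (fun t => φ.Sat A t) (funext fun i => ?_))
    exact congrArg x (Subsingleton.elim i (0 : Fin 1))
  · intro m R xs
    -- The components and coordinates of the tuple are generalized so that `c` can be replaced by
    -- the constant function without dependent rewriting.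
    have key : ∀ (c : Fin m → Fin 1) (x : Fin m → Fin 1 → A.carrier),
        (rel R c).Sat A (fun p => x p.1 p.2) ↔
          (r m R).Sat A (fun p => x p.1 0) := by
      intro c x
      obtain rfl : c = fun _ => 0 := Subsingleton.elim _ _
      refine (hr m R A _).trans (iff_of_eq (congrArg (fun t => (r m R).Sat A t) ?_))
      funext p
      exact congrArg (x p.1) (Subsingleton.elim p.2 (0 : Fin 1))
    refine Iff.trans ?_ (key (fun i => (xs i).1.1) (fun i => (xs i).1.2)).symm
    exact QForm.eval_map _ _ _ _ _

/-! ### Partial structures -/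

/-- The atomic facts about a partial structure on a set: membership of the elements in the
universe, and the relations. -/
abbrev Bit (W : Vocabulary) (J : Type*) : Type _ :=
  J ⊕ Σ R : (Σ n, W.Rel n), (Fin R.1 → J)

instance (W : Vocabulary) (J : Type*) [Finite J] : Finite (Bit W J) := by
  have := W.finite
  infer_instance

/-- A partial structure on a set: a subset which is the universe, and relations. -/
def PStr (W : Vocabulary) (J : Type*) : Type _ := Bit W J → Prop

namespace PStr

variable {V W : Vocabulary} {J E : Type*}

/-- The universe of a partial structure. -/
def Dom (P : PStr W J) (j : J) : Prop := P (.inl j)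

/-- The relations of a partial structure. -/
def Rel (P : PStr W J) {n : ℕ} (R : W.Rel n) (xs : Fin n → J) : Prop := P (.inr ⟨⟨n, R⟩, xs⟩)

theorem ext {P Q : PStr W J} (h : ∀ j, P.Dom j ↔ Q.Dom j)
    (h' : ∀ {n : ℕ} (R : W.Rel n) (xs : Fin n → J), P.Rel R xs ↔ Q.Rel R xs) : P = Q := by
  funext b
  obtain j | ⟨⟨n, R⟩, xs⟩ := b
  · exact propext (h j)
  · exact propext (h' R xs)

/-- The partial structure with the given universe and relations. -/
def mk (d : J → Prop) (r : ∀ {n : ℕ}, W.Rel n → (Fin n → J) → Prop) : PStr W J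
  | .inl j => d j
  | .inr ⟨⟨_, R⟩, xs⟩ => r R xs

/-- The relations hold only in the universe. -/
def Supported (P : PStr W J) : Prop :=
  ∀ {n : ℕ} (R : W.Rel n) (xs : Fin n → J), P.Rel R xs → ∀ i, P.Dom (xs i)

/-- The inverse image of a partial structure. -/
def comap (f : J → E) (P : PStr W E) : PStr W J :=
  mk (fun j => P.Dom (f j)) fun R xs => P.Rel R fun i => f (xs i)

/-- The relations of the disjoint union of two partial structures. -/
def CombRel (P : PStr W J) (Q : PStr V J) : ∀ {n : ℕ}, (W.prod V).Rel n → (Fin n → J) → Prop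
  | _, .left R, xs => P.Rel R xs
  | _, .right R, xs => Q.Rel R xs
  | _, .isFst, xs => P.Dom (xs 0)

/-- The universe after the application of a quantifier-free interpretation to a pair. -/
def StepDom (I : QInterp (W.prod V) W) (eq : J → J → Prop) (P : PStr W J) (Q : PStr V J)
    (j : J) : Prop :=
  (P.Dom j ∨ Q.Dom j) ∧ I.univ.Eval eq (CombRel P Q) fun _ => j

/-- The application of a quantifier-free interpretation to a pair of partial structures. -/
def step (I : QInterp (W.prod V) W) (eq : J → J → Prop) (P : PStr W J) (Q : PStr V J) :
    PStr W J :=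
  mk (StepDom I eq P Q) fun R xs =>
    (∀ i, StepDom I eq P Q (xs i)) ∧ (I.rel R).Eval eq (CombRel P Q) xs

theorem step_supported (I : QInterp (W.prod V) W) (eq : J → J → Prop) (P : PStr W J)
    (Q : PStr V J) : (step I eq P Q).Supported :=
  fun _ _ h => h.1

theorem combRel_comap (f : J → E) (P : PStr W E) (Q : PStr V E) {n : ℕ} (R : (W.prod V).Rel n)
    (xs : Fin n → J) :
    CombRel (P.comap f) (Q.comap f) R xs ↔ CombRel P Q R fun i => f (xs i) := by
  rcases R with R | R | _ <;> rfl

theorem eval_combRel_comap {α : Type} (φ : QForm (W.prod V) α) (eq : E → E → Prop) (f : J → E)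
    (P : PStr W E) (Q : PStr V E) (t : α → J) :
    φ.Eval (fun x y => eq (f x) (f y)) (CombRel (P.comap f) (Q.comap f)) t ↔
      φ.Eval eq (CombRel P Q) fun a => f (t a) := by
  refine Iff.trans ?_ (QForm.eval_comp f eq (CombRel P Q) t φ)
  exact QForm.eval_congr (eq := fun x y => eq (f x) (f y)) (eq' := fun x y => eq (f x) (f y))
    (rel := CombRel (P.comap f) (Q.comap f)) (rel' := fun R xs => CombRel P Q R fun i => f (xs i))
    t φ (fun _ _ => Iff.rfl) fun R xs => combRel_comap f P Q R _

/-- The locality that makes the automaton finite: in the absence of quantifiers, a step commutes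
with restriction to named elements. The map need not be injective, because equality is pulled back
along it too. -/
theorem step_comap (I : QInterp (W.prod V) W) (eq : E → E → Prop) (f : J → E) (P : PStr W E)
    (Q : PStr V E) :
    step I (fun x y => eq (f x) (f y)) (P.comap f) (Q.comap f) = (step I eq P Q).comap f := by
  have h : ∀ j, StepDom I (fun x y => eq (f x) (f y)) (P.comap f) (Q.comap f) j ↔
      StepDom I eq P Q (f j) := fun j =>
    and_congr_right fun _ => eval_combRel_comap I.univ eq f P Q fun _ => j
  exact ext h fun R xs =>
    and_congr (forall_congr' fun i => h _) (eval_combRel_comap (I.rel R) eq f P Q xs)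

end PStr

/-! ### Partial structures realized as structures, and the run as a sequence of steps -/

section

variable {V W : Vocabulary} {E : Type u} [Finite E]

/-- A partial structure, as a structure. -/
def PStr.sub (P : PStr W E) : FinStr.{u} W where
  carrier := {e : E // P.Dom e}
  str := W.mkStr _ fun R xs => P.Rel R fun i => (xs i).1

/-- The disjoint union of two partial structures, as a structure. -/
def PStr.combStr (P : PStr W E) (Q : PStr V E) : FinStr.{u} (W.prod V) where
  carrier := {e : E // P.Dom e ∨ Q.Dom e}
  str := (W.prod V).mkStr _ fun R xs => PStr.CombRel P Q R fun i => (xs i).1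

/-- Disjoint universes make the gluing map injective; supportedness lets a tuple satisfying a
relation be lifted to the summand that the relation comes from. -/
theorem PStr.sub_prod_sub_iso {P : PStr W E} {Q : PStr V E} (hP : P.Supported)
    (hQ : Q.Supported) (h : ∀ e, P.Dom e → ¬ Q.Dom e) :
    (P.sub.prod Q.sub).Iso (P.combStr Q) := by
  let f : {e : E // P.Dom e} ⊕ {e : E // Q.Dom e} → {e : E // P.Dom e ∨ Q.Dom e} :=
    Sum.elim (fun x => ⟨x.1, .inl x.2⟩) fun x => ⟨x.1, .inr x.2⟩
  have hf : Function.Bijective f := by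
    constructor
    · rintro (⟨x, hx⟩ | ⟨x, hx⟩) (⟨y, hy⟩ | ⟨y, hy⟩) hxy <;>
        obtain rfl : x = y := congrArg Subtype.val hxy
      · rfl
      · exact (h _ hx hy).elim
      · exact (h _ hy hx).elim
      · rfl
    · rintro ⟨x, hx | hx⟩
      · exact ⟨.inl ⟨x, hx⟩, rfl⟩
      · exact ⟨.inr ⟨x, hx⟩, rfl⟩
  refine FinStr.iso_of_equiv (Equiv.ofBijective f hf) ?_
  rintro n (R | R | _) xs
  · constructor
    · intro hR
      refine ⟨fun i => ⟨_, hP R _ hR i⟩, funext fun i => hf.1 rfl, hR⟩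
    · rintro ⟨ys, rfl, hR⟩
      exact hR
  · constructor
    · intro hR
      refine ⟨fun i => ⟨_, hQ R _ hR i⟩, funext fun i => hf.1 rfl, hR⟩
    · rintro ⟨ys, rfl, hR⟩
      exact hR
  · change P.Dom (f (xs 0)).1 ↔ Sum.isLeft (xs 0) = true
    rcases xs 0 with x | x
    · exact iff_of_true x.2 rfl
    · exact iff_of_false (fun hx => h _ hx x.2) (by simp)

theorem PStr.eval_combStr (P : PStr W E) (Q : PStr V E) {α : Type} (φ : QForm (W.prod V) α)
    (v : α → {e : E // P.Dom e ∨ Q.Dom e}) :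
    φ.Sat (P.combStr Q) v ↔ φ.Eval Eq (PStr.CombRel P Q) fun a => (v a).1 := by
  rw [← QForm.eval_comp]
  exact QForm.eval_congr _ _ (fun x y => Subtype.ext_iff) fun R xs => Iff.rfl

/-- Both sides select the same elements of `E`; the extra guard in the relations of `PStr.step` is
automatic for tuples from the selected universe. -/
theorem PStr.apply_combStr_iso (I : QInterp (W.prod V) W) (P : PStr W E) (Q : PStr V E) :
    (I.apply (P.combStr Q)).Iso (PStr.step I Eq P Q).sub := by
  have h : ∀ x : {e : E // P.Dom e ∨ Q.Dom e}, I.univ.Sat (P.combStr Q) (fun _ => x) ↔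
      I.univ.Eval Eq (PStr.CombRel P Q) fun _ => x.1 := fun x => P.eval_combStr Q _ _
  refine FinStr.iso_of_equiv
    ⟨fun x => ⟨x.1.1, x.1.2, (h _).1 x.2⟩, fun x => ⟨⟨x.1, x.2.1⟩, (h _).2 x.2.2⟩,
      fun _ => rfl, fun _ => rfl⟩ ?_
  intro n R xs
  refine Iff.trans ?_ (P.eval_combStr Q (I.rel R) fun i => (xs i).1).symm
  exact and_iff_right fun i => ⟨(xs i).1.2, (h _).1 (xs i).2⟩

theorem foldl_induction {k : ℕ} {α : Type*} (C : ℕ → α → Prop) (f : α → Fin k → α) {x : α}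
    (h₀ : C 0 x) (h : ∀ (i : Fin k) (a : α), C i a → C (i + 1) (f a i)) :
    C k (Fin.foldl k f x) := by
  induction k with
  | zero => simpa using h₀
  | succ k ih =>
    rw [Fin.foldl_succ_last]
    exact h (Fin.last k) _ (ih (fun a i => f a i.castSucc) fun i a ha => h i.castSucc a ha)

/-- The last state of a run is the last of a sequence of partial structures. -/
theorem lastState_iso_sub {S : StrClass.{u} V} {G : StrClass.{u} W}
    {δ : (G.prod S).Obj → G.Obj} (I : QInterp (W.prod V) W)
    (hδ : ∀ A, (I.apply A.1).Iso (δ A).1) (B : G.Obj) {k : ℕ} (A : Fin k → S.Item)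
    (P : ℕ → PStr W E) (Q : Fin k → PStr V E) (hB : B.1.Iso (P 0).sub)
    (hP : ∀ i : Fin k, P (i + 1) = PStr.step I Eq (P i) (Q i))
    (hQ : ∀ i, (A i).1.1.Iso (Q i).sub) (hs : (P 0).Supported) (hs' : ∀ i, (Q i).Supported)
    (hd : ∀ (i : Fin k) (e : E), (P i).Dom e → ¬ (Q i).Dom e) :
    (lastState δ B A).1.Iso (P k).sub := by
  refine (foldl_induction (fun i (B : G.Obj) => B.1.Iso (P i).sub ∧ (P i).Supported) _
    ⟨hB, hs⟩ ?_).1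
  rintro i B ⟨hB, hs⟩
  rw [hP]
  refine ⟨(hδ _).symm.trans ((I.apply_iso ?_).trans (PStr.apply_combStr_iso I (P i) (Q i))),
    PStr.step_supported _ _ _ _⟩
  exact (FinStr.prod_iso hB (hQ i)).trans (PStr.sub_prod_sub_iso hs (hs' i) (hd i))

/-- The last state of a run depends only on the isomorphism type of the initial state. -/
theorem lastState_congr {S : StrClass.{u} V} {G : StrClass.{u} W}
    {δ : (G.prod S).Obj → G.Obj} (I : QInterp (W.prod V) W)
    (hδ : ∀ A, (I.apply A.1).Iso (δ A).1) {B B' : G.Obj} (h : B.1.Iso B'.1) {k : ℕ}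
    (A : Fin k → S.Item) : (lastState δ B A).1.Iso (lastState δ B' A).1 := by
  induction k with
  | zero => simpa [lastState] using h
  | succ k ih =>
    unfold lastState at ih ⊢
    rw [Fin.foldl_succ_last, Fin.foldl_succ_last]
    exact (hδ _).symm.trans ((I.apply_iso
      (FinStr.prod_iso (ih fun i => A i.castSucc) (FinStr.Iso.refl _))).trans
      (hδ (StrClass.pair _ _)))

end

/-! ### The run on a list -/

section

variable {V W : Vocabulary} {k : ℕ}

/-- The initial partial structure: the initial state, with all further elements outside. -/
def initPStr (B : FinStr.{u} W) (α : Type*) : PStr W (B.carrier ⊕ α) :=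
  PStr.mk (fun j => j.isLeft = true)
    fun R xs => ∃ bs : Fin _ → B.carrier, xs = (fun i => .inl (bs i)) ∧ B.Holds R bs

/-- One item of a list. -/
def itemPStr (β : Type*) (A : Fin k → FinStr.{u} V) (i : Fin k) :
    PStr V (β ⊕ Σ i, (A i).carrier) :=
  PStr.mk (fun j => ∃ a, j = .inr ⟨i, a⟩)
    fun R xs => ∃ ys : Fin _ → (A i).carrier, xs = (fun j => .inr ⟨i, ys j⟩) ∧ (A i).Holds R ys

/-- The states of the run. -/
def runPStr (I : QInterp (W.prod V) W) (B : FinStr.{u} W) (A : Fin k → FinStr.{u} V) :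
    ℕ → PStr W (B.carrier ⊕ Σ i, (A i).carrier)
  | 0 => initPStr B _
  | i + 1 => if h : i < k then
      PStr.step I Eq (runPStr I B A i) (itemPStr _ A ⟨i, h⟩) else runPStr I B A i

theorem runPStr_succ (I : QInterp (W.prod V) W) (B : FinStr.{u} W) (A : Fin k → FinStr.{u} V)
    (i : Fin k) :
    runPStr I B A (i + 1) = PStr.step I Eq (runPStr I B A i) (itemPStr _ A i) := by
  simp [runPStr]

/-- Elements enter the state only together with their item. This yields the disjointness between the
current state and the next item. -/
theorem lt_of_dom_runPStr (I : QInterp (W.prod V) W) (B : FinStr.{u} W)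
    (A : Fin k → FinStr.{u} V) (n : ℕ) {i : Fin k} {a : (A i).carrier}
    (h : (runPStr I B A n).Dom (.inr ⟨i, a⟩)) : i < n := by
  induction n with
  | zero => exact absurd h (by simp [runPStr, initPStr, PStr.Dom, PStr.mk])
  | succ n ih =>
    by_cases hn : n < k
    · rw [runPStr_succ I B A ⟨n, hn⟩] at h
      obtain h | ⟨b, hb⟩ := h.1
      · exact (ih h).trans (Nat.lt_succ_self n)
      · cases hb
        exact Nat.lt_succ_self n
    -- Past the end of the list the bound holds trivially, since `n` is at least `k`.
    · exact i.2.trans_le (by omega)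

theorem iso_initPStr_sub (B : FinStr.{u} W) (α : Type u) [Finite α] :
    B.Iso (initPStr B α).sub := by
  refine FinStr.iso_of_equiv (Equiv.ofBijective (fun b => ⟨.inl b, rfl⟩) ⟨?_, ?_⟩) ?_
  · intro a b h
    exact Sum.inl_injective (congrArg Subtype.val h)
  · rintro ⟨b | a, h⟩
    · exact ⟨b, rfl⟩
    · exact absurd h (by simp [initPStr, PStr.Dom, PStr.mk])
  · intro n R xs
    constructor
    · rintro ⟨bs, h, hR⟩
      obtain rfl : xs = bs := funext fun i => Sum.inl_injective (congrFun h i)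
      exact hR
    · exact fun h => ⟨xs, rfl, h⟩

theorem iso_itemPStr_sub (β : Type u) [Finite β] (A : Fin k → FinStr.{u} V) (i : Fin k) :
    (A i).Iso (itemPStr β A i).sub := by
  have hinj : Function.Injective
      fun a : (A i).carrier => (.inr ⟨i, a⟩ : β ⊕ Σ i, (A i).carrier) := by
    intro a b h
    simpa using h
  refine FinStr.iso_of_equiv (Equiv.ofBijective (fun a => ⟨.inr ⟨i, a⟩, a, rfl⟩) ⟨?_, ?_⟩) ?_
  · intro a b h
    exact hinj (congrArg Subtype.val h)
  · rintro ⟨_, a, rfl⟩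
    exact ⟨a, rfl⟩
  · intro n R xs
    constructor
    · rintro ⟨bs, h, hR⟩
      obtain rfl : xs = bs := funext fun i => hinj (congrFun h i)
      exact hR
    · exact fun h => ⟨xs, rfl, h⟩

theorem lastState_iso_runPStr {S : StrClass.{u} V} {G : StrClass.{u} W}
    {δ : (G.prod S).Obj → G.Obj} (I : QInterp (W.prod V) W)
    (hδ : ∀ A, (I.apply A.1).Iso (δ A).1) (B : G.Obj) (A : Fin k → S.Item) :
    (lastState δ B A).1.Iso (runPStr I B.1 (fun i => (A i).1.1) k).sub := by
  refine lastState_iso_sub I hδ B A (runPStr I B.1 fun i => (A i).1.1)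
    (itemPStr _ fun i => (A i).1.1) (iso_initPStr_sub _ _) (runPStr_succ I _ _)
    (iso_itemPStr_sub _ _) ?_ ?_ ?_
  · rintro n R _ ⟨bs, rfl, _⟩ i
    rfl
  · rintro i n R _ ⟨ys, rfl, _⟩ j
    exact ⟨_, rfl⟩
  · rintro i _ h ⟨a, rfl⟩
    exact lt_irrefl _ (lt_of_dom_runPStr I _ _ _ h)

end

/-! ### Definable predicates -/

/-- Predicates about a structure, its elements, and its subsets. -/
abbrev MPred (V : Vocabulary) (α : Type) (m s : ℕ) : Type (u + 1) :=
  ∀ A : FinStr.{u} V, (α → A.carrier) → (Fin m → A.carrier) → (Fin s → Set A.carrier) → Prop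

/-- The predicate is defined by a formula. -/
def Definable {V : Vocabulary} {α : Type} {m s : ℕ} (P : MPred.{u} V α m s) : Prop :=
  ∃ φ : MSO V α m s, ∀ A v xs Xs, φ.Realize A v xs Xs ↔ P A v xs Xs

/-- Functions that select an element. -/
abbrev MTerm (V : Vocabulary) (α : Type) (m : ℕ) : Type (u + 1) :=
  ∀ A : FinStr.{u} V, (α → A.carrier) → (Fin m → A.carrier) → A.carrier

/-- The function is a variable. -/
def IsVar {V : Vocabulary} {α : Type} {m : ℕ} (t : MTerm.{u} V α m) : Prop :=
  ∃ i : α ⊕ Fin m, ∀ A v xs, t A v xs = Sum.elim v xs i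

namespace IsVar

variable {V : Vocabulary} {α : Type} {m : ℕ}

theorem free (a : α) : IsVar.{u} (V := V) (m := m) fun _ v _ => v a :=
  ⟨.inl a, fun _ _ _ => rfl⟩

theorem last : IsVar.{u} (V := V) (α := α) (m := m + 1) fun _ _ xs => xs (Fin.last m) :=
  ⟨.inr _, fun _ _ _ => rfl⟩

theorem init {t : MTerm.{u} V α m} (h : IsVar t) :
    IsVar.{u} (m := m + 1) fun A v xs => t A v (Fin.init xs) := by
  obtain ⟨a | i, h⟩ := h
  · exact ⟨.inl a, fun A v xs => h A v _⟩
  · exact ⟨.inr i.castSucc, fun A v xs => h A v _⟩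

end IsVar

namespace Definable

variable {V : Vocabulary} {α : Type} {m s : ℕ} {P Q : MPred.{u} V α m s}

theorem congr (h : Definable P) (h' : ∀ A v xs Xs, P A v xs Xs ↔ Q A v xs Xs) : Definable Q := by
  obtain ⟨φ, hφ⟩ := h
  exact ⟨φ, fun A v xs Xs => (hφ A v xs Xs).trans (h' A v xs Xs)⟩

theorem false : Definable.{u} (V := V) (α := α) (m := m) (s := s) fun _ _ _ _ => False :=
  ⟨.falsum, fun _ _ _ _ => Iff.rfl⟩

theorem imp (h : Definable P) (h' : Definable Q) :
    Definable fun A v xs Xs => P A v xs Xs → Q A v xs Xs := by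
  obtain ⟨φ, hφ⟩ := h
  obtain ⟨ψ, hψ⟩ := h'
  exact ⟨.imp φ ψ, fun A v xs Xs => imp_congr (hφ A v xs Xs) (hψ A v xs Xs)⟩

theorem not (h : Definable P) : Definable fun A v xs Xs => ¬ P A v xs Xs :=
  h.imp false

/-- Facts that do not depend on the input, such as those about the initial state, are decided
outside the logic. -/
theorem const (p : Prop) : Definable.{u} (V := V) (α := α) (m := m) (s := s) fun _ _ _ _ => p := by
  by_cases hp : p
  · exact (false.not).congr fun _ _ _ _ => by simp [hp]
  · exact false.congr fun _ _ _ _ => by simp [hp]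

theorem or (h : Definable P) (h' : Definable Q) :
    Definable fun A v xs Xs => P A v xs Xs ∨ Q A v xs Xs :=
  (h.not.imp h').congr fun _ _ _ _ => or_iff_not_imp_left.symm

theorem and (h : Definable P) (h' : Definable Q) :
    Definable fun A v xs Xs => P A v xs Xs ∧ Q A v xs Xs :=
  (h.imp h'.not).not.congr fun _ _ _ _ => by tauto

theorem iff (h : Definable P) (h' : Definable Q) :
    Definable fun A v xs Xs => P A v xs Xs ↔ Q A v xs Xs :=
  ((h.imp h').and (h'.imp h)).congr fun _ _ _ _ => iff_iff_implies_and_implies.symm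

theorem rel {k : ℕ} (R : V.Rel k) {t : Fin k → MTerm.{u} V α m} (h : ∀ i, IsVar (t i)) :
    Definable (s := s) fun A v xs _ => A.Holds R fun i => t i A v xs := by
  choose f hf using h
  exact ⟨.rel R f, fun A v xs Xs => by simp only [hf]; rfl⟩

theorem equal {t t' : MTerm.{u} V α m} (h : IsVar t) (h' : IsVar t') :
    Definable (s := s) fun A v xs _ => t A v xs = t' A v xs := by
  obtain ⟨i, hi⟩ := h
  obtain ⟨j, hj⟩ := h'
  exact ⟨.equal i j, fun A v xs Xs => by
    beta_reduce; rw [hi, hj]; rfl⟩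

theorem mem {t : MTerm.{u} V α m} (h : IsVar t) (X : Fin s) :
    Definable fun A v xs Xs => t A v xs ∈ Xs X := by
  obtain ⟨i, hi⟩ := h
  exact ⟨.mem i X, fun A v xs Xs => by
    beta_reduce; rw [hi]; rfl⟩

theorem all {P : ∀ A : FinStr.{u} V, (α → A.carrier) → (Fin m → A.carrier) → A.carrier →
      (Fin s → Set A.carrier) → Prop}
    (h : Definable (m := m + 1) fun A v xs Xs => P A v (Fin.init xs) (xs (Fin.last m)) Xs) :
    Definable fun A v xs Xs => ∀ a, P A v xs a Xs := by
  obtain ⟨φ, hφ⟩ := h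
  refine ⟨.all φ, fun A v xs Xs => forall_congr' fun a => (hφ _ _ _ _).trans ?_⟩
  beta_reduce
  rw [Fin.init_snoc, Fin.snoc_last]

theorem ex {P : ∀ A : FinStr.{u} V, (α → A.carrier) → (Fin m → A.carrier) → A.carrier →
      (Fin s → Set A.carrier) → Prop}
    (h : Definable (m := m + 1) fun A v xs Xs => P A v (Fin.init xs) (xs (Fin.last m)) Xs) :
    Definable fun A v xs Xs => ∃ a, P A v xs a Xs :=
  (all (P := fun A v xs a Xs => ¬ P A v xs a Xs) h.not).not.congr
    fun _ _ _ _ => not_forall_not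

/-- A whole tuple of sets is guessed at once by quantifying away the last set variable repeatedly.
-/
theorem exSets {s : ℕ} {P : MPred.{u} V α m s} (h : Definable P) :
    Definable (s := 0) fun A v xs _ => ∃ Xs, P A v xs Xs := by
  induction s with
  | zero =>
    refine h.congr fun A v xs Xs => ⟨fun h => ⟨Xs, h⟩, fun ⟨Ys, h⟩ => ?_⟩
    rwa [Subsingleton.elim Xs Ys]
  | succ s ih =>
    obtain ⟨φ, hφ⟩ := h
    refine (ih (P := fun A v xs Xs => ¬ ∀ X, ¬ P A v xs (Fin.snoc Xs X)) ?_).congr ?_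
    · refine not ⟨.allSet (.imp φ .falsum), fun A v xs Xs => ?_⟩
      exact forall_congr' fun X => imp_congr_left (hφ _ _ _ _)
    · intro A v xs _
      constructor
      · rintro ⟨Xs, h⟩
        obtain ⟨X, hX⟩ := not_forall_not.1 h
        exact ⟨_, hX⟩
      · rintro ⟨Xs, h⟩
        refine ⟨Fin.init Xs, not_forall_not.2 ⟨Xs (Fin.last s), ?_⟩⟩
        rwa [Fin.snoc_init_self]

theorem finForall {ι : Type*} [Finite ι] {P : ι → MPred.{u} V α m s} (h : ∀ i, Definable (P i)) :
    Definable fun A v xs Xs => ∀ i, P i A v xs Xs := by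
  induction ι using Finite.induction_empty_option with
  | of_equiv e ih =>
    exact (ih fun i => h (e i)).congr fun _ _ _ _ => e.forall_congr_right (q := fun i => P i _ _ _ _)
  | h_empty => exact (const True).congr fun _ _ _ _ => by simp
  | h_option ih =>
    exact ((h none).and (ih fun i => h (some i))).congr fun _ _ _ _ =>
      (Option.forall (p := fun i => P i _ _ _ _)).symm

theorem finExists {ι : Type*} [Finite ι] {P : ι → MPred.{u} V α m s} (h : ∀ i, Definable (P i)) :
    Definable fun A v xs Xs => ∃ i, P i A v xs Xs :=
  (finForall fun i => (h i).not).not.congr fun _ _ _ _ => not_forall_not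

/-- The step function preserves definability. -/
theorem step {U W : Vocabulary} {J : Type*} (I : QInterp (W.prod U) W)
    {eq : J → J → MPred.{u} V α m s} {P : Bit W J → MPred.{u} V α m s}
    {Q : Bit U J → MPred.{u} V α m s} (heq : ∀ i j, Definable (eq i j)) (hP : ∀ b, Definable (P b))
    (hQ : ∀ b, Definable (Q b)) (b : Bit W J) :
    Definable fun A v xs Xs => PStr.step I (fun i j => eq i j A v xs Xs)
      (fun b => P b A v xs Xs) (fun b => Q b A v xs Xs) b := by
  have eval : ∀ {β : Type} (φ : QForm (W.prod U) β) (t : β → J),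
      Definable fun A v xs Xs => φ.Eval (fun i j => eq i j A v xs Xs)
        (PStr.CombRel (fun b => P b A v xs Xs) (fun b => Q b A v xs Xs)) t := by
    intro β φ t
    induction φ with
    | falsum => exact false
    | equal x y => exact heq _ _
    | rel R ts =>
      obtain R | R | _ := R
      · exact hP (.inr ⟨⟨_, R⟩, _⟩)
      · exact hQ (.inr ⟨⟨_, R⟩, _⟩)
      · exact hP (.inl _)
    | imp φ ψ ih ih' => exact ih.imp ih'
  have dom : ∀ j, Definable fun A v xs Xs => PStr.StepDom I (fun i j => eq i j A v xs Xs)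
      (fun b => P b A v xs Xs) (fun b => Q b A v xs Xs) j := fun j =>
    ((hP (.inl j)).or (hQ (.inl j))).and (eval _ _)
  obtain j | ⟨⟨n, R⟩, ts⟩ := b
  · exact dom j
  · exact (finForall fun i => dom (ts i)).and (eval _ _)

theorem exists_formula {P : MPred.{u} V α 0 0} (h : Definable P) :
    ∃ φ : Formula V α, ∀ A v, φ.Sat A v ↔ P A v Fin.elim0 Fin.elim0 := by
  obtain ⟨φ, hφ⟩ := h
  exact ⟨φ, fun A v => hφ A v _ _⟩

end Definable

/-! ### The run as a monadic second-order property -/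

section

variable {V W : Vocabulary} {α : Type}

/-- The order on the elements of a list. -/
def Le (A : FinStr.{u} V.list) (x y : A.carrier) : Prop :=
  A.Holds (V := V.list) (ListRel.le : ListRel V.Rel 2) ![x, y]

/-- The item of `x` is before the item of `y`. -/
def Lt (A : FinStr.{u} V.list) (x y : A.carrier) : Prop := Le A x y ∧ ¬ Le A y x

/-- The elements `x` and `y` are in the same item. -/
def Same (A : FinStr.{u} V.list) (x y : A.carrier) : Prop := Le A x y ∧ Le A y x

/-- The item of `x` is immediately before the item of `y`. -/
def Pred (A : FinStr.{u} V.list) (x y : A.carrier) : Prop :=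
  Lt A x y ∧ ¬ ∃ z, Lt A x z ∧ Lt A z y

/-- The relations of the item of `y`. -/
def letterRel (β : Type*) (A : FinStr.{u} V.list) (v : α → A.carrier) (y : A.carrier) :
    ∀ {n : ℕ}, V.Rel n → (Fin n → β ⊕ α) → Prop
  | 0, R, _ => A.Holds (V := V.list) (ListRel.nullary R : ListRel V.Rel 1) fun _ => y
  | n + 1, R, xs => ∃ as : Fin (n + 1) → α, xs = (fun i => .inr (as i)) ∧ Same A (v (as 0)) y ∧
      A.Holds (V := V.list) (ListRel.pos R : ListRel V.Rel (n + 1)) fun i => v (as i)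

/-- The item of `y`, restricted to the elements named by variables. -/
def letterPStr (β : Type*) (A : FinStr.{u} V.list) (v : α → A.carrier) (y : A.carrier) :
    PStr V (β ⊕ α) :=
  PStr.mk (fun j => ∃ a, j = .inr a ∧ Same A (v a) y) (letterRel β A v y)

/-- The state before the item of `y`, when the sets `X` encode the states after the items. -/
def prevPStr (B : FinStr.{u} W) (A : FinStr.{u} V.list) (X : Bit W (B.carrier ⊕ α) → Set A.carrier)
    (y : A.carrier) : PStr W (B.carrier ⊕ α) :=
  fun b => (∃ x, Pred A x y ∧ x ∈ X b) ∨ (¬ ∃ x, Lt A x y) ∧ initPStr B α b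

/-- The sets encode the states of the run. -/
def IsRun (I : QInterp (W.prod V) W) (B : FinStr.{u} W) (A : FinStr.{u} V.list)
    (v : α → A.carrier) (X : Bit W (B.carrier ⊕ α) → Set A.carrier) : Prop :=
  ∀ y b, y ∈ X b ↔ PStr.step I (fun i j => Sum.map id v i = Sum.map id v j)
    (prevPStr B A X y) (letterPStr _ A v y) b

/-- The state after the last item. -/
def Final (I : QInterp (W.prod V) W) (B : FinStr.{u} W) (A : FinStr.{u} V.list)
    (v : α → A.carrier) (b : Bit W (B.carrier ⊕ α)) : Prop :=
  ∃ X : Bit W (B.carrier ⊕ α) → Set A.carrier, IsRun I B A v X ∧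
    ((∃ y, (¬ ∃ z, Lt A y z) ∧ y ∈ X b) ∨ (¬ ∃ _ : A.carrier, True) ∧ initPStr B α b)

variable {m s : ℕ}

theorem definable_le {t t' : MTerm.{u} V.list α m} (h : IsVar t) (h' : IsVar t') :
    Definable (s := s) fun A v xs _ => Le A (t A v xs) (t' A v xs) := by
  refine (Definable.rel (V := V.list) (ListRel.le : ListRel V.Rel 2) (t := ![t, t']) ?_).congr ?_
  · intro i
    fin_cases i
    · exact h
    · exact h'
  · intro A v xs _
    refine iff_of_eq (congrArg _ (funext fun i => ?_))
    fin_cases i <;> rfl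

theorem definable_lt {t t' : MTerm.{u} V.list α m} (h : IsVar t) (h' : IsVar t') :
    Definable (s := s) fun A v xs _ => Lt A (t A v xs) (t' A v xs) :=
  (definable_le h h').and (definable_le h' h).not

theorem definable_same {t t' : MTerm.{u} V.list α m} (h : IsVar t) (h' : IsVar t') :
    Definable (s := s) fun A v xs _ => Same A (t A v xs) (t' A v xs) :=
  (definable_le h h').and (definable_le h' h)

theorem definable_pred {t t' : MTerm.{u} V.list α m} (h : IsVar t) (h' : IsVar t') :
    Definable (s := s) fun A v xs _ => Pred A (t A v xs) (t' A v xs) :=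
  (definable_lt h h').and
    (Definable.ex (P := fun A v xs a _ => Lt A (t A v xs) a ∧ Lt A a (t' A v xs))
      ((definable_lt h.init .last).and (definable_lt .last h'.init))).not

/-- Since `α` is finite, the search for variables naming the given positions is a finite
disjunction, in which the equations between names are constants. -/
theorem definable_letterPStr [Finite α] (β : Type*) {t : MTerm.{u} V.list α m} (h : IsVar t)
    (b : Bit V (β ⊕ α)) :
    Definable (s := s) fun A v xs _ => letterPStr β A v (t A v xs) b := by
  obtain j | ⟨⟨_ | n, R⟩, ts⟩ := b
  · exact Definable.finExists fun a => (Definable.const _).and (definable_same (.free a) h)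
  · exact Definable.rel (V := V.list) (ListRel.nullary R : ListRel V.Rel 1) fun _ => h
  · exact Definable.finExists fun as => (Definable.const _).and
      ((definable_same (.free _) h).and (Definable.rel (V := V.list)
        (ListRel.pos R : ListRel V.Rel (n + 1)) fun i => .free (as i)))

theorem definable_prevPStr (B : FinStr.{u} W) (e : Bit W (B.carrier ⊕ α) → Fin s)
    {t : MTerm.{u} V.list α m} (h : IsVar t) (b : Bit W (B.carrier ⊕ α)) :
    Definable fun A v xs Xs => prevPStr B A (fun b => Xs (e b)) (t A v xs) b :=
  (Definable.ex (P := fun A v xs a Xs => Pred A a (t A v xs) ∧ a ∈ Xs (e b))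
    ((definable_pred .last h.init).and (.mem .last _))).or
  ((Definable.ex (P := fun A v xs a _ => Lt A a (t A v xs))
    (definable_lt .last h.init)).not.and (.const _))

theorem definable_valuation_eq (β : Type*) (i j : β ⊕ α) :
    Definable.{u} (V := V) (m := m) (s := s)
      fun A v _ _ => (Sum.map id v i : β ⊕ A.carrier) = Sum.map id v j := by
  obtain i | i := i <;> obtain j | j := j
  · exact (Definable.const (i = j)).congr fun _ _ _ _ => by simp
  · exact Definable.false.congr fun _ _ _ _ => by simp
  · exact Definable.false.congr fun _ _ _ _ => by simp
  · exact (Definable.equal (.free i) (.free j)).congr fun _ _ _ _ => by simp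

theorem definable_final [Finite α] (I : QInterp (W.prod V) W) (B : FinStr.{u} W)
    (b : Bit W (B.carrier ⊕ α)) :
    Definable (m := 0) (s := 0) fun A v _ _ => Final I B A v b := by
  -- One set variable per bit; there are finitely many because the vocabulary, the initial state and
  -- the variables are finite.
  obtain ⟨n, ⟨e⟩⟩ := Finite.exists_equiv_fin (Bit W (B.carrier ⊕ α))
  refine (Definable.exSets (s := n) (P := fun A v _ Xs => IsRun I B A v (fun b => Xs (e b)) ∧
    ((∃ y, (¬ ∃ z, Lt A y z) ∧ y ∈ Xs (e b)) ∨
      (¬ ∃ _ : A.carrier, True) ∧ initPStr B α b)) ?_).congr ?_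
  · refine .and ?_ (.or ?_ (.and (.not ?_) (.const _)))
    · refine Definable.all (P := fun A v _ y Xs => ∀ b, y ∈ Xs (e b) ↔
        PStr.step I (fun i j => Sum.map id v i = Sum.map id v j)
          (prevPStr B A (fun b => Xs (e b)) y) (letterPStr _ A v y) b) ?_
      refine Definable.finForall fun b => (Definable.mem .last _).iff ?_
      exact Definable.step I (fun i j => definable_valuation_eq _ i j)
        (definable_prevPStr B e .last) (definable_letterPStr _ .last) b
    · exact Definable.ex (P := fun A _ _ y Xs => (¬ ∃ z, Lt A y z) ∧ y ∈ Xs (e b))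
        ((Definable.ex (P := fun A _ xs z _ => Lt A (xs (Fin.last 0)) z)
          (definable_lt (IsVar.init .last) .last)).not.and (.mem .last _))
    · exact Definable.ex (P := fun _ _ _ _ _ => True) (.const True)
  · intro A v _ _
    constructor
    · rintro ⟨Xs, h⟩
      exact ⟨_, h⟩
    · rintro ⟨X, h⟩
      refine ⟨fun i => X (e.symm i), ?_⟩
      simpa using h

end

/-! ### Correctness of the formulas on structures of lists -/

section

variable {V W : Vocabulary} {α : Type} {k : ℕ}

theorem initPStr_comap (B : FinStr.{u} W) {γ : Type*} (v : α → γ) :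
    (initPStr B γ).comap (Sum.map id v) = initPStr B α := by
  refine PStr.ext (fun j => ?_) fun R xs => ?_
  · exact iff_of_eq (congrArg (· = true) (Sum.isLeft_map id v j))
  · constructor
    · rintro ⟨bs, h, hR⟩
      refine ⟨bs, funext fun i => ?_, hR⟩
      have := congrFun h i
      rcases hx : xs i with b | a
      · simpa [hx] using this
      · simp [hx] at this
    · rintro ⟨bs, rfl, hR⟩
      exact ⟨bs, rfl, hR⟩

/-- The preorder identifies the item of `y`, so the item is recovered from the list structure alone.
Its nullary relations are read off at `y`. -/
theorem letterPStr_list (β : Type*) (A : Fin k → FinStr.{u} V)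
    (v : α → (FinStr.list A).carrier) (y : (FinStr.list A).carrier) :
    letterPStr β (FinStr.list A) v y = (itemPStr β A y.1).comap (Sum.map id v) := by
  have same : ∀ x, Same (FinStr.list A) x y ↔ ∃ z, x = ⟨y.1, z⟩ := by
    rintro ⟨i, z⟩
    obtain ⟨j, y⟩ := y
    constructor
    · rintro ⟨h, h'⟩
      obtain rfl : i = j := le_antisymm h h'
      exact ⟨z, rfl⟩
    · rintro ⟨z', h⟩
      obtain rfl : i = j := congrArg Sigma.fst h
      exact ⟨le_refl i, le_refl i⟩
  refine PStr.ext (fun j => ?_) fun {n} R xs => ?_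
  · constructor
    · rintro ⟨a, rfl, h⟩
      obtain ⟨z, hz⟩ := (same _).1 h
      exact ⟨z, congrArg Sum.inr hz⟩
    · rintro ⟨z, hz⟩
      rcases j with b | a
      · exact absurd hz (by simp)
      · exact ⟨a, rfl, (same _).2 ⟨z, Sum.inr_injective hz⟩⟩
  · rcases n with _ | n
    · constructor
      · exact fun h => ⟨Fin.elim0, Subsingleton.elim _ _, h⟩
      · rintro ⟨ys, -, h⟩
        rwa [Subsingleton.elim ys Fin.elim0] at h
    · constructor
      · rintro ⟨as, rfl, h, i, ys, hys, hR⟩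
        obtain ⟨z, hz⟩ := (same _).1 h
        -- The list relation provides some item containing the whole tuple; the first entry, which
        -- exists in positive arity, shows that it is the item of `y`.
        obtain rfl : i = y.1 := congrArg Sigma.fst ((congrFun hys 0).symm.trans hz)
        exact ⟨ys, funext fun l => congrArg Sum.inr (congrFun hys l), hR⟩
      · rintro ⟨ys, h, hR⟩
        have hx : ∀ l, ∃ a, xs l = .inr a ∧ v a = ⟨y.1, ys l⟩ := by
          intro l
          have := congrFun h l
          rcases hl : xs l with b | a
          · rw [hl] at this
            exact absurd this (by simp)
          · rw [hl] at this
            exact ⟨a, rfl, Sum.inr_injective this⟩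
        choose as h₁ h₂ using hx
        exact ⟨as, funext h₁, (same _).2 ⟨_, h₂ 0⟩, y.1, ys, funext h₂, hR⟩

variable (I : QInterp (W.prod V) W) (B : FinStr.{u} W) (A : Fin k → FinStr.{u} V)
  (v : α → (FinStr.list A).carrier)

/-- The states of the run, restricted to the elements named by variables. -/
def traceOf (n : ℕ) : PStr W (B.carrier ⊕ α) := (runPStr I B A n).comap (Sum.map id v)

theorem traceOf_zero : traceOf I B A v 0 = initPStr B α := initPStr_comap B v

theorem traceOf_succ (y : (FinStr.list A).carrier) :
    traceOf I B A v (y.1 + 1) = PStr.step I (fun i j => Sum.map id v i = Sum.map id v j)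
      (traceOf I B A v y.1) (letterPStr _ (FinStr.list A) v y) := by
  unfold traceOf
  rw [runPStr_succ, letterPStr_list]
  exact (PStr.step_comap I Eq (Sum.map id v) (runPStr I B A y.1) (itemPStr _ A y.1)).symm

theorem lt_list (x y : (FinStr.list A).carrier) : Lt (FinStr.list A) x y ↔ x.1.1 < y.1.1 := by
  change x.1.1 ≤ y.1.1 ∧ ¬ y.1.1 ≤ x.1.1 ↔ _
  omega

/-- Empty items would be invisible to the order; nonemptiness provides an element strictly between
whenever an index is skipped. -/
theorem pred_list (hA : ∀ i, Nonempty (A i).carrier) (x y : (FinStr.list A).carrier) :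
    Pred (FinStr.list A) x y ↔ x.1.1 + 1 = y.1.1 := by
  unfold Pred
  simp only [lt_list]
  constructor
  · rintro ⟨h, h'⟩
    by_contra hne
    obtain ⟨z⟩ := hA ⟨x.1.1 + 1, by omega⟩
    exact h' ⟨⟨_, z⟩, Nat.lt_succ_self _, by simp only; omega⟩
  · intro h
    exact ⟨by omega, fun ⟨z, h₁, h₂⟩ => by omega⟩

theorem prevPStr_list (hA : ∀ i, Nonempty (A i).carrier)
    (X : Bit W (B.carrier ⊕ α) → Set (FinStr.list A).carrier) (y : (FinStr.list A).carrier)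
    (hX : ∀ x : (FinStr.list A).carrier, x.1 < y.1 →
      ∀ b, x ∈ X b ↔ traceOf I B A v (x.1 + 1) b) :
    prevPStr B (FinStr.list A) X y = traceOf I B A v y.1 := by
  funext b
  refine propext ?_
  unfold prevPStr
  simp only [lt_list, pred_list A hA]
  obtain ⟨⟨i, hi⟩, a⟩ := y
  rcases i with _ | n
  · simp [traceOf_zero]
  · have hn : n < k := by omega
    obtain ⟨z⟩ := hA ⟨n, hn⟩
    constructor
    · rintro (⟨x, hx, h⟩ | ⟨h, _⟩)
      · have := (hX x (Fin.lt_def.2 (by omega)) b).1 h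
        simpa only [hx] using this
      · exact (h ⟨⟨⟨n, hn⟩, z⟩, Nat.lt_succ_self n⟩).elim
    · intro h
      exact .inl ⟨⟨⟨n, hn⟩, z⟩, rfl, (hX ⟨⟨n, hn⟩, z⟩ (Nat.lt_succ_self n) b).2 h⟩

/-- The automaton is deterministic: by strong induction on the item index, the local conditions
force the sets to be the true trace. -/
theorem isRun_list (hA : ∀ i, Nonempty (A i).carrier)
    (X : Bit W (B.carrier ⊕ α) → Set (FinStr.list A).carrier) :
    IsRun I B (FinStr.list A) v X ↔ ∀ x b, x ∈ X b ↔ traceOf I B A v (x.1 + 1) b := by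
  constructor
  · intro h
    have key : ∀ (n : ℕ) (x : (FinStr.list A).carrier), x.1.1 = n →
        ∀ b, x ∈ X b ↔ traceOf I B A v (x.1 + 1) b := by
      intro n
      induction n using Nat.strong_induction_on with
      | _ n ih =>
        rintro x rfl b
        rw [h x b, traceOf_succ, prevPStr_list I B A v hA X x fun y hy => ih _ hy y rfl]
    exact fun x => key _ x rfl
  · intro h y b
    rw [h y b, traceOf_succ, prevPStr_list I B A v hA X y fun x _ => h x]

theorem final_list (hA : ∀ i, Nonempty (A i).carrier) (b : Bit W (B.carrier ⊕ α)) :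
    Final I B (FinStr.list A) v b ↔ traceOf I B A v k b := by
  unfold Final
  simp only [isRun_list I B A v hA, lt_list]
  -- Every correct encoding gives the same answer at the end, so one equivalence serves both
  -- directions of the existential statement.
  have last : ∀ X : Bit W (B.carrier ⊕ α) → Set (FinStr.list A).carrier,
      (∀ x b, x ∈ X b ↔ traceOf I B A v (x.1 + 1) b) →
      (((∃ y : (FinStr.list A).carrier,
        (¬ ∃ z : (FinStr.list A).carrier, y.1.1 < z.1.1) ∧ y ∈ X b) ∨
      (¬ ∃ _ : (FinStr.list A).carrier, True) ∧ initPStr B α b) ↔ traceOf I B A v k b) := by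
    intro X hX
    rcases k with _ | k
    · have h : ¬ ∃ _ : (FinStr.list A).carrier, True := fun ⟨x, _⟩ => x.1.elim0
      have h' : ∀ p : (FinStr.list A).carrier → Prop, ¬ ∃ x, p x := fun p ⟨x, _⟩ => x.1.elim0
      simp only [h, h', traceOf_zero, false_or, not_false_eq_true, true_and]
    · obtain ⟨a⟩ := hA (Fin.last k)
      constructor
      · rintro (⟨y, h, hy⟩ | ⟨h, _⟩)
        · have : y.1.1 = k := by
            by_contra hne
            exact h ⟨⟨Fin.last k, a⟩, by have := y.1.2; simp only [Fin.val_last]; omega⟩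
          have hy' := (hX y b).1 hy
          rwa [this] at hy'
        · exact (h ⟨⟨_, a⟩, trivial⟩).elim
      · intro h
        refine .inl ⟨⟨Fin.last k, a⟩, fun ⟨z, hz⟩ => ?_, (hX _ b).2 h⟩
        have := z.1.2
        simp only [Fin.val_last] at hz
        omega
  constructor
  · rintro ⟨X, hX, h⟩
    exact (last X hX).1 h
  · intro h
    -- The sets are read off from the actual run; the `+ 1` is there because an element stores the
    -- state after its item.
    exact ⟨fun b => {x | traceOf I B A v (x.1 + 1) b}, fun _ _ => Iff.rfl,
      (last _ fun _ _ => Iff.rfl).2 h⟩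

end

/-! ### The interpretation -/

section

variable {V W : Vocabulary}

/-- The number of free variables needed to name an element of the output: none for elements of the
initial state, and one for elements of the input. -/
def nameDim {β : Type*} : Option β → ℕ
  | some _ => 0
  | none => 1

/-- The element with a given name. -/
def named {β γ : Type*} : ∀ c : Option β, (Fin (nameDim c) → γ) → β ⊕ γ
  | some b, _ => .inl b
  | none, x => .inr (x (0 : Fin 1))

theorem map_named {β γ γ' : Type*} (f : γ → γ') (c : Option β) (x : Fin (nameDim c) → γ) :
    Sum.map id f (named c x) = named c fun i => f (x i) := by
  cases c <;> rfl

/-- This identifies the candidates of the functor with the ambient set of the run: `some b` yields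
one constant, `none` a copy of the input. -/
theorem named_bijective {β γ : Type*} {n : ℕ} (e : Fin n ≃ Option β) :
    Function.Bijective fun x : Σ c, (Fin (nameDim (e c)) → γ) => named (e x.1) x.2 := by
  have h : Function.Bijective fun x : Σ c : Option β, (Fin (nameDim c) → γ) =>
      named x.1 x.2 := by
    constructor
    · rintro ⟨_ | b, x⟩ ⟨_ | c, y⟩ h
      · refine congrArg (Sigma.mk _) (funext fun i => ?_)
        rw [Subsingleton.elim (α := Fin 1) i 0]
        exact Sum.inr_injective (show Sum.inr (x (0 : Fin 1)) = Sum.inr (y (0 : Fin 1)) from h)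
      · cases h
      · cases h
      · obtain rfl : b = c := Sum.inl_injective h
        exact congrArg (Sigma.mk _) (funext fun i => i.elim0)
    · rintro (b | a)
      · exact ⟨⟨some b, fun i => i.elim0⟩, rfl⟩
      · exact ⟨⟨none, fun _ => a⟩, rfl⟩
  exact h.comp (Equiv.sigmaCongrLeft (β := fun c => Fin (nameDim c) → γ) e).bijective

/-- The fold of a quantifier-free interpretation is a linear MSO interpretation. -/
theorem exists_linear_iso_runPStr (I : QInterp (W.prod V) W) (B : FinStr.{u} W) :
    ∃ F : Interpretation V.list W, F.IsLinear ∧ ∀ (k : ℕ) (A : Fin k → FinStr.{u} V),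
      (∀ i, Nonempty (A i).carrier) → (F.apply (FinStr.list A)).Iso (runPStr I B A k).sub := by
  obtain ⟨n, ⟨e⟩⟩ := Finite.exists_equiv_fin (Option B.carrier)
  have hfinal : ∀ (α : Type) [Finite α] (b : Bit W (B.carrier ⊕ α)),
      ∃ φ : Formula V.list α, ∀ (A : FinStr.{u} V.list) v, φ.Sat A v ↔ Final I B A v b :=
    fun α _ b => (definable_final I B b).exists_formula
  choose φ hφ using hfinal
  -- Each formula asks for a bit of the final state about symbolic names. With `id` the variable of
  -- a component names itself; in relations, `⟨i, p⟩` is the variable of the `i`-th argument.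
  refine ⟨⟨n, fun c => nameDim (e.symm c), fun c => φ _ (.inl (named (e.symm c) id)),
    fun {m} R c => φ _ (.inr ⟨⟨m, R⟩, fun i => named (e.symm (c i)) fun p => ⟨i, p⟩⟩)⟩, ?_, ?_⟩
  · intro c
    change nameDim (e.symm c) ≤ 1
    cases e.symm c <;> simp [nameDim]
  intro k A hA
  refine FinStr.iso_of_equiv (Equiv.subtypeEquiv
    (Equiv.ofBijective _ (named_bijective (γ := (FinStr.list A).carrier) e.symm)) ?_) ?_
  · rintro ⟨c, x⟩
    refine (hφ _ _ _ _).trans ((final_list I B A x hA _).trans ?_)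
    -- By definition, the trace at a name is the full run at the element so named.
    change (runPStr I B A k).Dom (Sum.map id x (named (e.symm c) id)) ↔ _
    exact iff_of_eq (congrArg (runPStr I B A k).Dom (map_named _ _ _))
  · intro m R xs
    refine Iff.symm ((hφ _ _ _ _).trans ((final_list I B A _ hA _).trans ?_))
    refine iff_of_eq (congrArg ((runPStr I B A k).Rel R) (funext fun i => ?_))
    exact map_named _ _ _

theorem exists_linear_iso_lastState {S : StrClass.{u} V} {G : StrClass.{u} W}
    {δ : (G.prod S).Obj → G.Obj} (hδ : IsQFInterpretation δ) (B : G.Obj) :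
    ∃ F : Interpretation V.list W, F.IsLinear ∧ ∀ (k : ℕ) (A : Fin k → S.Item)
      (w : FinStr.{u} V.list), (FinStr.list fun i => (A i).1.1).Iso w →
        (F.apply w).Iso (lastState δ B A).1 := by
  obtain ⟨D, hD, hδ⟩ := hδ
  obtain ⟨I, hI⟩ := hD.exists_qInterp
  obtain ⟨F, hF, h⟩ := exists_linear_iso_runPStr I B.1
  refine ⟨F, hF, fun k A w hw => (F.apply_iso hw.symm).trans ((h k _ fun i => (A i).2).trans ?_)⟩
  exact (lastState_iso_runPStr I (fun P => (hI P.1).symm.trans (hδ P)) B A).symm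

/-- Any list representing `w` may be chosen, since the last state of each one is isomorphic to the
same output `F.apply w`. -/
theorem exists_isFold {S : StrClass.{u} V} {G : StrClass.{u} W}
    {δ : (G.prod S).Obj → G.Obj} (hδ : IsQFInterpretation δ) (B : G.Obj) :
    ∃ f : S.list.Obj → G.Obj, IsFold δ B f := by
  obtain ⟨F, -, h⟩ := exists_linear_iso_lastState hδ B
  choose k A hA using fun w : S.list.Obj => w.2
  exact ⟨fun w => lastState δ B (A w), fun k' A' w hw =>
    (h k' A' w.1 hw).symm.trans (h (k w) (A w) w.1 (hA w))⟩

theorem IsFold.isLinearMSOInterpretation {S : StrClass.{u} V} {G : StrClass.{u} W}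
    {δ : (G.prod S).Obj → G.Obj} (hδ : IsQFInterpretation δ) {B : G.Obj}
    {f : S.list.Obj → G.Obj} (hf : IsFold δ B f) : IsLinearMSOInterpretation f := by
  obtain ⟨F, hF, h⟩ := exists_linear_iso_lastState hδ B
  refine ⟨F, hF, fun w => ?_⟩
  obtain ⟨k, A, hA⟩ := w.2
  exact (h k A w.1 hA).trans (hf k A w hA)

theorem IsFold.of_iso {S : StrClass.{u} V} {G : StrClass.{u} W}
    {δ : (G.prod S).Obj → G.Obj} (hδ : IsQFInterpretation δ) {B B' : G.Obj} (h : B.1.Iso B'.1)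
    {f : S.list.Obj → G.Obj} (hf : IsFold δ B f) : IsFold δ B' f := by
  obtain ⟨D, hD, hδ⟩ := hδ
  obtain ⟨I, hI⟩ := hD.exists_qInterp
  exact fun k A w hw =>
    (lastState_congr I (fun P => (hI P.1).symm.trans (hδ P)) h A).symm.trans (hf k A w hw)

end

/-! ### Composition with quantifier-free interpretations -/

/-- Renaming of the free element variables. -/
def MSO.rename {V : Vocabulary} {α β : Type} (f : α → β) : ∀ {m s : ℕ}, MSO V α m s → MSO V β m s
  | _, _, .falsum => .falsum
  | _, _, .equal x y => .equal (Sum.map f id x) (Sum.map f id y)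
  | _, _, .rel R ts => .rel R fun i => Sum.map f id (ts i)
  | _, _, .mem x X => .mem (Sum.map f id x) X
  | _, _, .imp φ ψ => .imp (rename f φ) (rename f ψ)
  | _, _, .all φ => .all (rename f φ)
  | _, _, .allSet φ => .allSet (rename f φ)

theorem MSO.realize_rename {V : Vocabulary} {α β : Type} (f : α → β) (A : FinStr.{u} V)
    (v : β → A.carrier) {m s : ℕ} (φ : MSO V α m s) (xs : Fin m → A.carrier)
    (Xs : Fin s → Set A.carrier) :
    (φ.rename f).Realize A v xs Xs ↔ φ.Realize A (fun a => v (f a)) xs Xs := by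
  have h : ∀ {m : ℕ} (xs : Fin m → A.carrier) (t : α ⊕ Fin m),
      Sum.elim v xs (Sum.map f id t) = Sum.elim (fun a => v (f a)) xs t := by
    rintro m xs (a | i) <;> rfl
  induction φ with
  | falsum => rfl
  | equal x y => simp only [rename, Realize, h]
  | rel R ts => simp only [rename, Realize, h]
  | mem x X => simp only [rename, Realize, h]
  | imp φ ψ ih ih' => simp only [rename, Realize, ih, ih']
  | all φ ih => simp only [rename, Realize, ih]
  | allSet φ ih => simp only [rename, Realize, ih]

section

variable {V W : Vocabulary} {α : Type}

theorem Definable.sat {β : Type} (φ : Formula V β) (f : β → α) :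
    Definable.{u} (V := V) (m := 0) (s := 0) fun A v _ _ => φ.Sat A fun b => v (f b) := by
  refine ⟨φ.rename f, fun A v xs Xs => (MSO.realize_rename f A v φ xs Xs).trans ?_⟩
  rw [Subsingleton.elim xs Fin.elim0, Subsingleton.elim Xs Fin.elim0]
  rfl

/-- Candidates from different components are never equal; within one component, equality is a finite
conjunction over the coordinates. -/
theorem Interpretation.definable_candidate_eq (I : Interpretation V W) {c d : Fin I.comps}
    (y : Fin (I.dim c) → α) (z : Fin (I.dim d) → α) :
    Definable.{u} (V := V) (m := 0) (s := 0)
      fun A v _ _ => (⟨c, fun p => v (y p)⟩ : I.Candidate A) = ⟨d, fun p => v (z p)⟩ := by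
  by_cases h : c = d
  · subst h
    exact (Definable.finForall fun p => Definable.equal (.free (y p)) (.free (z p))).congr
      fun A v _ _ => by simp [funext_iff]
  · exact Definable.false.congr fun A v _ _ => by simp [h]

/-- The relations, on all candidates. -/
def Interpretation.CandidateRel (I : Interpretation V W) (A : FinStr.{u} V) {m : ℕ} (R : W.Rel m)
    (xs : Fin m → I.Candidate A) : Prop :=
  (I.rel R fun i => (xs i).1).Sat A fun p => (xs p.1).2 p.2

theorem Interpretation.definable_eval (I : Interpretation V W) {β : Type} (φ : QForm W β)
    (c : β → Fin I.comps) (y : ∀ b, Fin (I.dim (c b)) → α) :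
    Definable.{u} (V := V) (m := 0) (s := 0) fun A v _ _ =>
      φ.Eval (J := I.Candidate A) Eq (I.CandidateRel A) fun b => ⟨c b, fun p => v (y b p)⟩ := by
  induction φ with
  | falsum => exact Definable.false
  | equal a b => exact I.definable_candidate_eq (y a) (y b)
  | rel R ts => exact Definable.sat (I.rel R fun i => c (ts i)) fun p => y (ts p.1) p.2
  | imp φ ψ ih ih' => exact ih.imp ih'

/-- Truth in the output can be computed on all candidates, because without quantifiers the
restriction to the selected universe plays no role. -/
theorem Interpretation.sat_apply (I : Interpretation V W) (A : FinStr.{u} V) {β : Type}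
    (φ : QForm W β) (x : β → (I.apply A).carrier) :
    φ.Sat (I.apply A) x ↔ φ.Eval (J := I.Candidate A) Eq (I.CandidateRel A) fun b => (x b).1 := by
  refine Iff.trans ?_ (QForm.eval_comp Subtype.val Eq (I.CandidateRel A) x φ)
  exact QForm.eval_congr (eq := Eq) (eq' := fun x y => x.1 = y.1) x φ
    (fun _ _ => Subtype.ext_iff) fun R xs => Iff.rfl

/-- Substituting the formulas of `I` into those of `Q` needs no relativization of quantifiers. The
components and dimensions are those of `I`, so linearity carries over verbatim. -/
theorem Interpretation.exists_comp {U : Vocabulary} (I : Interpretation V W) (Q : QInterp W U) :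
    ∃ F : Interpretation V U, (I.IsLinear → F.IsLinear) ∧
      ∀ A : FinStr.{u} V, (F.apply A).Iso (Q.apply (I.apply A)) := by
  choose φ hφ using fun c : Fin I.comps =>
    ((Definable.sat.{u} (I.univ c) id).and
      (I.definable_eval Q.univ (fun _ => c) fun _ => id)).exists_formula
  choose ψ hψ using fun {m : ℕ} (R : U.Rel m) (c : Fin m → Fin I.comps) =>
    (I.definable_eval.{u} (α := Σ i, Fin (I.dim (c i))) (Q.rel R) c
      fun i p => ⟨i, p⟩).exists_formula
  refine ⟨⟨I.comps, I.dim, φ, fun R c => ψ R c⟩, id, fun A => ?_⟩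
  refine FinStr.iso_of_equiv ⟨fun x => ⟨⟨x.1, ((hφ _ _ _).1 x.2).1⟩,
    (I.sat_apply A _ _).2 ((hφ _ _ _).1 x.2).2⟩,
    fun x => ⟨x.1.1, (hφ _ _ _).2 ⟨x.1.2, (I.sat_apply A _ _).1 x.2⟩⟩,
    fun _ => rfl, fun _ => rfl⟩ ?_
  intro m R xs
  refine Iff.trans ?_ (hψ R (fun i => (xs i).1.1) A fun p => (xs p.1).1.2 p.2).symm
  exact I.sat_apply A _ _

/-- Linear MSO interpretations can be post-composed with quantifier-free interpretations. -/
theorem IsLinearMSOInterpretation.comp {U : Vocabulary} {C : StrClass.{u} V} {D : StrClass.{u} W}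
    {E : StrClass.{u} U} {f : C.Obj → D.Obj} {g : D.Obj → E.Obj} {h : C.Obj → E.Obj}
    (hf : IsLinearMSOInterpretation f) (hg : IsQFInterpretation g)
    (hh : ∀ w, (g (f w)).1.Iso (h w).1) : IsLinearMSOInterpretation h := by
  obtain ⟨I, hI, hIf⟩ := hf
  obtain ⟨K, hK, hKg⟩ := hg
  obtain ⟨Q, hQ⟩ := hK.exists_qInterp
  obtain ⟨F, hF, hFQ⟩ := I.exists_comp Q
  exact ⟨F, hF hI, fun w => (hFQ w.1).trans
    ((Q.apply_iso (hIf w)).trans ((hQ _).symm.trans ((hKg _).trans (hh w))))⟩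

theorem IsQFInterpretation.map_iso {C : StrClass.{u} V} {D : StrClass.{u} W} {f : C.Obj → D.Obj}
    (hf : IsQFInterpretation f) {A B : C.Obj} (h : A.1.Iso B.1) : (f A).1.Iso (f B).1 := by
  obtain ⟨I, -, hI⟩ := hf
  exact (hI A).symm.trans ((I.apply_iso h).trans (hI B))

end

/-! ### Transducers -/

/-- A structure with one element. -/
def oneObj : ListType.one.cls.{u}.Obj :=
  ⟨{ carrier := PUnit
     str := Vocabulary.empty.mkStr _ fun R _ => R.elim }, ⟨inferInstanceAs (Unique PUnit)⟩⟩

/-- Makes the choice of a one-element structure irrelevant: the initial configuration is determined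
up to isomorphism, and `IsFold.of_iso` transfers the fold. -/
theorem one_iso (A B : ListType.one.cls.{u}.Obj) : A.1.Iso B.1 := by
  obtain ⟨A, ⟨hA⟩⟩ := A
  obtain ⟨B, ⟨hB⟩⟩ := B
  exact FinStr.iso_of_equiv (Equiv.ofUnique _ _) fun R => Empty.elim R

theorem SimpleSST.exists_computes (T : SimpleSST.{u}) : ∃ f, T.Computes f := by
  obtain ⟨g, hg⟩ := exists_isFold (S := (ListType.alphabet T.inp).cls) T.trans_qf (T.init oneObj)
  exact ⟨fun w => T.final (g w), fun e =>
    ⟨g, hg.of_iso T.trans_qf (T.init_qf.map_iso (one_iso _ _)), fun w => .refl _⟩⟩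

theorem SimpleSST.Computes.isLinearMSOInterpretation {T : SimpleSST.{u}}
    {f : (ListType.alphabet T.inp).list.cls.Obj → (ListType.alphabet T.out).list.cls.{u}.Obj}
    (hf : T.Computes f) : IsLinearMSOInterpretation f := by
  obtain ⟨g, hg, h⟩ := hf oneObj
  exact (hg.isLinearMSOInterpretation T.trans_qf).comp T.final_qf h

end FoldMSO

theorem theorem1 :
    (∀ (V W : FoldMSO.Vocabulary) (S : FoldMSO.StrClass.{u} V) (G : FoldMSO.StrClass.{u} W)
        (δ : (G.prod S).Obj → G.Obj) (B₀ : G.Obj),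
        FoldMSO.IsQFInterpretation δ →
          (∃ f : S.list.Obj → G.Obj, FoldMSO.IsFold δ B₀ f) ∧
          ∀ f : S.list.Obj → G.Obj, FoldMSO.IsFold δ B₀ f → FoldMSO.IsLinearMSOInterpretation f) ∧
    (∀ T : FoldMSO.SimpleSST.{u},
        (∃ f, T.Computes f) ∧ ∀ f, T.Computes f → FoldMSO.IsLinearMSOInterpretation f) :=
  ⟨fun _ _ _ _ _ B₀ hδ => ⟨FoldMSO.exists_isFold hδ B₀,
    fun _ hf => hf.isLinearMSOInterpretation hδ⟩,
  fun T => ⟨T.exists_computes, fun _ hf => hf.isLinearMSOInterpretation⟩⟩
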